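/- \textbf{Setting.} Let $(X,d)$ be a non-compact ultrametric space without isolated points (the ``continuous'' case), in which every closed ball is compact and whose isometry group acts transitively. Let $m$ be a Radon measure on $X$ with full support which is invariant under all isometries of $X$. Let $\mathcal B$ be the set of all closed balls of positive radius, and let $C:\mathcal B\to(0,\infty)$ satisfy $C(A)=C(B)$ whenever $\operatorname{diam}A=\operatorname{diam}B$, and $\sum_{T\in\mathcal B,\,T\supseteq B}C(T)<\infty$ for every $B\in\mathcal B$. The hierarchical Laplacian is $$Lf(x)=\sum_{B\in\mathcal B,\,B\ni x}C(B)\Big(f(x)-\frac1{m(B)}\int_B f\,dm\Big),\qquad f\in\mathcal D,$$ where $\mathcal D$ is the space of locally constant functions with compact support. Fix a horocycle $\mathcal H$, i.e. the set of all balls in $\mathcal B$ having the same diameter as some given ball in $\mathcal B$, and let $V=\sum_{B\in\mathcal H}\sigma(B)1_B$ with arbitrary $\sigma:\mathcal H\to\mathbb R$. Denote by $L$ also the closure of $(L,\mathcal D)$ in $L^2(X,m)$, and let $H$ be the closure in $L^2(X,m)$ of the operator $f\mapsto Lf+Vf$ on $\mathcal D$. For $T\in\mathcal B$ let $T'$ be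 the smallest ball in $\mathcal B$ with $T'\supsetneq T$, and let $f_T=\frac{1_T}{m(T)}-\frac{1_{T'}}{m(T')}$. For $A\in\mathcal H$ let $\mathcal L_A$ be the closed linear span of $\{f_T:T\subsetneq A\}$; it is invariant under $L$, and we let $L_A$ be the restriction of $L$ to $\mathcal L_A$. The set $\mathfrak S_{\mathcal H}:=\operatorname{Spec}(L_A)$ does not depend on $A\in\mathcal H$. Let $\mathfrak R_V:=V(X)$ be the range of $V$. We say that $H$ has discrete spectrum if every point of $\operatorname{Spec}(H)$ is isolated in $\operatorname{Spec}(H)$ and is an eigenvalue of finite multiplicity. \textbf{Theorem.} \begin{enumerate} \item If $H$ has discrete spectrum, then $|V(x)|\to\infty$ as $x\to\infty$ in $X$ (i.e. outside compact sets). \item Suppose that $|V(x)|\to\infty$ as $x\to\infty$. Then: \begin{enumerate} \item $\operatorname{Spec}(H)$ has no accumulation points if and only if the set $\mathfrak S_{\mathcal H}+\mathfrak R_V$ has no accumulation points; \item $H$ has discrete spectrum if and only if $\mathfrak S_{\mathcal H}+\mathfrak R_V$ has no accumulation points, repetitions being counted; that is, if and only if the set $\mathfrak S_{\mathcal H}+\mathfrak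 R_V$ has no accumulation points and every number $z$ can be written as $z=s+r$ with $s\in\mathfrak S_{\mathcal H}$, $r\in\mathfrak R_V$ in only finitely many ways. \end{enumerate} \end{enumerate} -/

import Mathlib

open MeasureTheory Filter Topology
open scoped Pointwise ENNReal

noncomputable section

/-! ### Spectral theory of unbounded operators -/

namespace UnboundedOp

variable {E : Type*} [NormedAddCommGroup E] [NormedSpace ℂ E]

/-- `z` belongs to the resolvent set of `T` if `T - z` maps the domain of `T` bijectively onto `E`,
with a bounded inverse `R`. -/
def resolventSet (T : E →ₗ.[ℂ] E) : Set ℂ :=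
  {z | ∃ R : E →L[ℂ] E,
    (∀ w : E, ∃ u : T.domain, (u : E) = R w ∧ T u - z • (u : E) = w) ∧
    ∀ u : T.domain, R (T u - z • (u : E)) = u}

/-- The spectrum of an unbounded operator. -/
def spec (T : E →ₗ.[ℂ] E) : Set ℂ := (resolventSet T)ᶜ

/-- The eigenspace `{u ∈ dom T : T u = z u}`. -/
def eigenspace (T : E →ₗ.[ℂ] E) (z : ℂ) : Submodule ℂ E :=
  T.graph.comap (LinearMap.prod LinearMap.id (z • LinearMap.id))

theorem mem_eigenspace_iff (T : E →ₗ.[ℂ] E) (z : ℂ) (u : E) :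
    u ∈ eigenspace T z ↔ ∃ h : u ∈ T.domain, T ⟨u, h⟩ = z • u := by
  constructor
  · intro h
    obtain ⟨y, hy, hy'⟩ := (LinearPMap.mem_graph_iff T).1 (Submodule.mem_comap.1 h)
    change (y : E) = u at hy
    change T y = z • u at hy'
    subst hy
    exact ⟨y.2, hy'⟩
  · rintro ⟨h, h'⟩
    exact (LinearPMap.mem_graph_iff T).2 ⟨⟨u, h⟩, rfl, h'⟩

/-- The set `S` of complex numbers has no accumulation points (in `ℂ`). -/
def NoAccPts (S : Set ℂ) : Prop := ∀ z : ℂ, ¬ AccPt z (𝓟 S)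

/-- `T` has discrete spectrum: every point of the spectrum is isolated in the spectrum and is
an eigenvalue of finite multiplicity. -/
def HasDiscreteSpectrum (T : E →ₗ.[ℂ] E) : Prop :=
  ∀ z ∈ spec T, ¬ AccPt z (𝓟 (spec T)) ∧
    eigenspace T z ≠ ⊥ ∧ FiniteDimensional ℂ (eigenspace T z)

/-- The graph of the restriction of `T` to a subspace `K`. -/
def restrictGraph (T : E →ₗ.[ℂ] E) (K : Submodule ℂ E) : Submodule ℂ (K × K) :=
  T.graph.comap (K.subtype.prodMap K.subtype)

/-- The restriction of `T` to a subspace `K`, as an operator in `K`: its domain consists of the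
`u ∈ K ∩ dom T` such that `T u ∈ K` (if `K` is invariant under `T`, of all `u ∈ K ∩ dom T`). -/
def restrict (T : E →ₗ.[ℂ] E) (K : Submodule ℂ E) : K →ₗ.[ℂ] K :=
  (restrictGraph T K).toLinearPMap

theorem restrict_graph (T : E →ₗ.[ℂ] E) (K : Submodule ℂ E) :
    (restrict T K).graph = restrictGraph T K := by
  refine Submodule.toLinearPMap_graph_eq _ ?_
  rintro ⟨u, v⟩ h (hu : u = 0)
  subst hu
  have h' : (((0 : K) : E), (v : E)) ∈ T.graph := h
  exact Subtype.ext (T.graph_fst_eq_zero_snd h' rfl)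

end UnboundedOp

/-! ### Balls, horocycles, hierarchical Laplacians and Schrödinger operators -/

namespace Hierarchical

section Balls

variable {X : Type*} [MetricSpace X]

/-- The isometries of `X` act transitively. -/
def IsHomogeneous (X : Type*) [MetricSpace X] : Prop :=
  ∀ x y : X, ∃ e : X ≃ᵢ X, e x = y

/-- `B` is a (closed) ball of positive radius. -/
def IsBall (B : Set X) : Prop := ∃ (x : X) (r : ℝ), 0 < r ∧ B = Metric.closedBall x r

/-- The horocycle of a ball `A`: all balls with the same diameter as `A`. -/
def horocycle (A : Set X) : Set (Set X) := {B | IsBall B ∧ Metric.diam B = Metric.diam A}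

/-- `B ⊂ B'` are nearest neighbouring balls. -/
def IsParent (B B' : Set X) : Prop :=
  IsBall B ∧ IsBall B' ∧ B ⊂ B' ∧ ∀ T : Set X, IsBall T → B ⊆ T → T ⊆ B' → T = B ∨ T = B'

/-- The conditions on the function `C` on balls which defines a homogeneous hierarchical Laplacian:
positivity, dependence on the diameter only, and `∑_{T ⊇ B} C(T) < ∞` for every ball `B`. -/
structure IsChoiceFunction (C : Set X → ℝ) : Prop where
  pos : ∀ B, IsBall B → 0 < C B
  eq_of_diam_eq : ∀ A B, IsBall A → IsBall B → Metric.diam A = Metric.diam B → C A = C B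
  summable : ∀ B, IsBall B → Summable fun T : {T : Set X // IsBall T ∧ B ⊆ T} => C T

/-- The potential `V = ∑_{B ∈ 𝓗} σ(B) 1_B`, where `𝓗` is the horocycle of `A` (at every point
exactly one term is present). -/
def potential (A : Set X) (σ : horocycle A → ℝ) (x : X) : ℝ :=
  ∑ᶠ B : horocycle A, (B : Set X).indicator (fun _ => σ B) x

end Balls

variable {X : Type*} [MetricSpace X] [MeasurableSpace X]

/-- `g(x) = ∑_{B ∋ x} C(B) (f(x) - m(B)⁻¹ ∫_B f dm)` for all `x`, with a convergent series:
`g` is the hierarchical Laplacian of `f`, in the pointwise sense. -/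
def IsLaplacianOf (C : Set X → ℝ) (m : Measure X) (f g : X → ℂ) : Prop :=
  ∀ x, HasSum (fun B : {B : Set X // IsBall B ∧ x ∈ B} =>
    (C B : ℂ) * (f x - ((m.real B : ℝ) : ℂ)⁻¹ * ∫ y in (B : Set X), f y ∂m)) (g x)

variable [BorelSpace X]

theorem hasSum_of_eq {ι : Type*} {f g : ι → ℂ} {a : ℂ} (h : ∀ b, f b = g b) (hg : HasSum g a) :
    HasSum f a := by
  rwa [show f = g from funext h]

/-- The graph of the operator `f ↦ L f + V f` in `L²(X, m)`, defined on the space of locally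
constant functions `f` with compact support. -/
def minimalGraph (C : Set X → ℝ) (m : Measure X) [IsFiniteMeasureOnCompacts m] (V : X → ℝ) :
    Submodule ℂ (Lp ℂ 2 m × Lp ℂ 2 m) where
  carrier := {p | ∃ f g : X → ℂ, IsLocallyConstant f ∧ HasCompactSupport f ∧
    IsLaplacianOf C m f g ∧ (p.1 =ᵐ[m] f) ∧ (p.2 =ᵐ[m] fun x => g x + (V x : ℂ) * f x)}
  zero_mem' := by
    refine ⟨0, 0, IsLocallyConstant.const 0, HasCompactSupport.zero, ?_, Lp.coeFn_zero _ _ _, ?_⟩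
    · intro x
      simp [hasSum_zero]
    · filter_upwards [Lp.coeFn_zero ℂ 2 m] with x hx
      simpa using hx
  add_mem' := by
    rintro p q ⟨f, g, hf, hfc, hL, h1, h2⟩ ⟨f', g', hf', hfc', hL', h1', h2'⟩
    have hi := hf.continuous.integrable_of_hasCompactSupport (μ := m) hfc
    have hi' := hf'.continuous.integrable_of_hasCompactSupport (μ := m) hfc'
    refine ⟨f + f', g + g', hf.add hf', hfc.add hfc', ?_, ?_, ?_⟩
    · intro x
      refine hasSum_of_eq (fun B => ?_) ((hL x).add (hL' x))
      simp only [Pi.add_apply]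
      rw [integral_add hi.integrableOn hi'.integrableOn]
      ring
    · filter_upwards [Lp.coeFn_add p.1 q.1, h1, h1'] with x hx hx1 hx2
      simp only [Prod.fst_add, hx, Pi.add_apply, hx1, hx2]
    · filter_upwards [Lp.coeFn_add p.2 q.2, h2, h2'] with x hx hx1 hx2
      simp only [Prod.snd_add, hx, Pi.add_apply, hx1, hx2]
      ring
  smul_mem' := by
    rintro c p ⟨f, g, hf, hfc, hL, h1, h2⟩
    refine ⟨fun x => c * f x, fun x => c * g x, hf.comp (c * ·),
      hfc.mul_left (f := fun _ => c), ?_, ?_, ?_⟩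
    · intro x
      refine hasSum_of_eq (fun B => ?_) ((hL x).mul_left c)
      rw [integral_const_mul]
      ring
    · filter_upwards [Lp.coeFn_smul c p.1, h1] with x hx hx1
      simp only [Prod.smul_fst, hx, Pi.smul_apply, hx1, smul_eq_mul]
    · filter_upwards [Lp.coeFn_smul c p.2, h2] with x hx hx1
      simp only [Prod.smul_snd, hx, Pi.smul_apply, hx1, smul_eq_mul]
      ring

/-- The operator `f ↦ L f + V f` in `L²(X, m)`, defined on the space of locally constant functions
`f` with compact support. -/
def minimalOperator (C : Set X → ℝ) (m : Measure X) [IsFiniteMeasureOnCompacts m] (V : X → ℝ) :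
    Lp ℂ 2 m →ₗ.[ℂ] Lp ℂ 2 m :=
  (minimalGraph C m V).toLinearPMap

theorem minimalOperator_graph (C : Set X → ℝ) (m : Measure X) [IsFiniteMeasureOnCompacts m]
    (V : X → ℝ) : (minimalOperator C m V).graph = minimalGraph C m V := by
  refine Submodule.toLinearPMap_graph_eq _ ?_
  rintro ⟨u, v⟩ ⟨f, g, hf, hfc, hL, h1, h2⟩ (hu : u = 0)
  subst hu
  have hf0 : f =ᵐ[m] 0 := h1.symm.trans (Lp.coeFn_zero ℂ 2 m)
  refine (Lp.eq_zero_iff_ae_eq_zero).2 ?_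
  filter_upwards [h2, hf0] with x hx2 hx0
  have hg : g x = 0 := by
    refine (hL x).unique ?_
    refine hasSum_of_eq (fun B => ?_) hasSum_zero
    rw [integral_eq_zero_of_ae (ae_restrict_of_ae hf0), hx0]
    simp
  have hx2' : v x = g x + (V x : ℂ) * f x := hx2
  rw [hx2', hg, hx0]
  simp

/-- The Schrödinger type operator `H = L + V`: the closure of its restriction to locally constant
functions with compact support. -/
def schrodinger (C : Set X → ℝ) (m : Measure X) [IsFiniteMeasureOnCompacts m] (V : X → ℝ) :
    Lp ℂ 2 m →ₗ.[ℂ] Lp ℂ 2 m :=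
  (minimalOperator C m V).closure

/-- The homogeneous hierarchical Laplacian `L`, as a self-adjoint operator in `L²(X, m)`. -/
def laplacian (C : Set X → ℝ) (m : Measure X) [IsFiniteMeasureOnCompacts m] :
    Lp ℂ 2 m →ₗ.[ℂ] Lp ℂ 2 m :=
  schrodinger C m 0

/-- The function `f_T = 1_T / m(T) - 1_{T'} / m(T')`. -/
def haar (m : Measure X) (T T' : Set X) (x : X) : ℂ :=
  T.indicator (fun _ => ((m.real T : ℝ) : ℂ)⁻¹) x -
    T'.indicator (fun _ => ((m.real T' : ℝ) : ℂ)⁻¹) x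

/-- The closed subspace `𝓛_A` of `L²(X, m)` spanned by the functions `f_T` for the balls `T ⊊ A`
(where `T'` denotes the nearest neighbouring ball containing `T`). -/
def localSpace (m : Measure X) (A : Set X) : Submodule ℂ (Lp ℂ 2 m) :=
  (Submodule.span ℂ {u : Lp ℂ 2 m | ∃ T T' : Set X,
    IsParent T T' ∧ T ⊂ A ∧ u =ᵐ[m] haar m T T'}).topologicalClosure

/-- `𝔖_𝓗 = Spec(L_A)`, where `L_A` is the restriction of `L` to the invariant subspace `𝓛_A`.
By homogeneity, it is the same for all balls `A` of a horocycle `𝓗`. -/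
def localSpectrum (C : Set X → ℝ) (m : Measure X) [IsFiniteMeasureOnCompacts m] (A : Set X) :
    Set ℂ :=
  UnboundedOp.spec (UnboundedOp.restrict (laplacian C m) (localSpace m A))

/-- The range of a real potential, as a set of complex numbers. -/
def potentialRange (V : X → ℝ) : Set ℂ := Set.range fun x => (V x : ℂ)

end Hierarchical

end

/-! The indicators `1_B`, `B` in the horocycle, together with the functions `f_T`, `T` strictly
inside some ball of the horocycle, are total in `L²`, and the two families are orthogonal to each
other. On `f_T` with `T` inside `B` the operator is diagonal: `L f_T = λ(T') f_T` with `λ(T') = ∑_{S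
⊇ T'} C(S)`, and `V` is the constant `σ(B)` on the support. On the span of the `1_B` only the balls
containing a ball of the horocycle contribute to `L`, so `L` acts there as a bounded symmetric
operator `L₀`, and `H = L₀ + σ` with `σ` diagonal. `BlockModel` records exactly this structure;
`model` and `model_graph` produce it, and everything spectral is proved for block models.

By homogeneity the same numbers `λ` occur in every block, each with finite multiplicity
(`LocalPair.finite_eigenvalue`, `LocalPair.exists_eigenvalue`). Hence the eigenvalues belonging to
the `f_T` are precisely the sums `λ + σ(B)`, while `𝔖` lies between the set of all `λ` and its
closure (`eigenvalue_mem_localSpectrum`, `localSpectrum_subset`).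

If `|σ|` is bounded on an infinite set of blocks, then for one fixed `λ` the numbers `λ + σ(B)`
accumulate or one of them repeats infinitely often; this excludes discrete spectrum. If `|σ| → ∞`,
vectors in the span of the `1_B` that are bounded in graph norm form a precompact set
(`totallyBounded_energyBall`), so this part contributes only eigenvalues of finite multiplicity,
finitely many in each disc (`finite_complEigenvalues`, `finiteDimensional_of_le_compl`). Up to this
harmless set the spectrum is the closure of `{λ + σ(B)}` (`spec_subset`), and `spectrum_dichotomy`
reads off the theorem. -/

noncomputable section

/-! ### Resolvent sets of closed operators in Hilbert spaces -/

namespace UnboundedOp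

section Spectrum

variable {E : Type*} [NormedAddCommGroup E] [NormedSpace ℂ E]

/-- If `z` admits approximate eigenvectors, then `z` is in the spectrum. -/
theorem mem_spec_of_approx_eigenvector (T : E →ₗ.[ℂ] E) (z : ℂ)
    (h : ∀ ε > 0, ∃ p ∈ T.graph, p.1 ≠ 0 ∧ ‖p.2 - z • p.1‖ ≤ ε * ‖p.1‖) : z ∈ spec T := by
  rintro ⟨R, -, hR⟩
  obtain ⟨p, hp, hp0, hpε⟩ := h (1 / (2 * (‖R‖ + 1))) (by positivity)
  obtain ⟨u, hu1, hu2⟩ := (LinearPMap.mem_graph_iff T).1 hp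
  have h1 : R (p.2 - z • p.1) = p.1 := by rw [← hu1, ← hu2]; exact hR u
  have h2 : ‖p.1‖ ≤ ‖R‖ * (1 / (2 * (‖R‖ + 1)) * ‖p.1‖) := by
    calc ‖p.1‖ = ‖R (p.2 - z • p.1)‖ := by rw [h1]
      _ ≤ ‖R‖ * ‖p.2 - z • p.1‖ := R.le_opNorm _
      _ ≤ _ := by gcongr
  have h3 : 0 < ‖p.1‖ := norm_pos_iff.2 hp0
  have h4 : ‖R‖ * (1 / (2 * (‖R‖ + 1)) * ‖p.1‖) ≤ (1 / 2) * ‖p.1‖ := by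
    rw [← mul_assoc]
    gcongr
    rw [mul_one_div, div_le_div_iff₀ (by positivity) (by norm_num)]
    nlinarith [norm_nonneg R]
  linarith

theorem mem_eigenspace_iff_mem_graph (T : E →ₗ.[ℂ] E) (z : ℂ) (u : E) :
    u ∈ eigenspace T z ↔ (u, z • u) ∈ T.graph := Iff.rfl

/-- The spectrum contains the closure of the set of eigenvalues. -/
theorem mem_spec_of_mem_closure (T : E →ₗ.[ℂ] E) (W : Set ℂ)
    (hW : ∀ w ∈ W, ∃ u ∈ eigenspace T w, u ≠ 0) (z : ℂ) (hz : z ∈ closure W) : z ∈ spec T := by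
  refine mem_spec_of_approx_eigenvector T z fun ε hε => ?_
  obtain ⟨w, hw, hzw⟩ := Metric.mem_closure_iff.1 hz ε hε
  obtain ⟨u, hu, hu0⟩ := hW w hw
  refine ⟨(u, w • u), hu, hu0, ?_⟩
  rw [← sub_smul, norm_smul, ← dist_eq_norm, dist_comm]
  gcongr

end Spectrum

variable {E : Type*} [NormedAddCommGroup E] [InnerProductSpace ℂ E]

local notation "⟪" x ", " y "⟫" => inner ℂ x y

/-- A criterion for membership in the resolvent set, in terms of a submodule of the graph. -/
theorem mem_resolventSet_of_core [CompleteSpace E] (T : E →ₗ.[ℂ] E) (G : Submodule ℂ (E × E))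
    (hT : IsClosed (T.graph : Set (E × E))) (hG : G ≤ T.graph) (z : ℂ) (c : ℝ) (hc : 0 < c)
    (hlb : ∀ p ∈ G, c * ‖p.1‖ ≤ ‖p.2 - z • p.1‖)
    (hd : ∀ y, (∀ p ∈ G, ⟪p.2 - z • p.1, y⟫ = 0) → y = 0)
    (hinj : ∀ p ∈ T.graph, p.2 = z • p.1 → p.1 = 0) : z ∈ resolventSet T := by
  set G' := G.topologicalClosure
  have hG' : G' ≤ T.graph := G.topologicalClosure_minimal hG hT
  have hlb' : ∀ p ∈ G', c * ‖p.1‖ ≤ ‖p.2 - z • p.1‖ := by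
    have hcl : IsClosed {p : E × E | c * ‖p.1‖ ≤ ‖p.2 - z • p.1‖} :=
      isClosed_le (by fun_prop) (by fun_prop)
    intro p hp
    exact closure_minimal (show (G : Set (E × E)) ⊆ _ from hlb) hcl hp
  let φ : E × E →L[ℂ] E := ContinuousLinearMap.snd ℂ E E - z • ContinuousLinearMap.fst ℂ E E
  have hφ : ∀ p, φ p = p.2 - z • p.1 := fun p => rfl
  let ψ : G' →L[ℂ] E := φ.comp G'.subtypeL
  have hψ : ∀ p : G', ψ p = (p : E × E).2 - z • (p : E × E).1 := fun p => rfl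
  have hK : 0 ≤ 1 / c + 1 + ‖z‖ / c := by positivity
  have hanti : AntilipschitzWith ⟨1 / c + 1 + ‖z‖ / c, hK⟩ ψ := by
    -- The constant covers the graph norm: `1 / c` controls the first coordinate and `1 + ‖z‖ / c`
    -- the second. Being bounded below, `ψ` has closed range.
    refine AddMonoidHomClass.antilipschitz_of_bound ψ fun p => ?_
    have h1 := hlb' p p.2
    rw [← hψ] at h1
    have h1' : ‖(p : E × E).1‖ ≤ ‖ψ p‖ / c := by rw [le_div_iff₀ hc]; linarith
    have h2 : ‖(p : E × E).2‖ ≤ ‖ψ p‖ + ‖z‖ * (‖ψ p‖ / c) := by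
      calc ‖(p : E × E).2‖ = ‖ψ p + z • (p : E × E).1‖ := by rw [hψ]; simp
        _ ≤ ‖ψ p‖ + ‖z • (p : E × E).1‖ := norm_add_le _ _
        _ ≤ _ := by rw [norm_smul]; gcongr
    have h3 : ‖p‖ = max ‖(p : E × E).1‖ ‖(p : E × E).2‖ := rfl
    rw [h3]
    change _ ≤ (1 / c + 1 + ‖z‖ / c) * ‖ψ p‖
    have e : (1 / c + 1 + ‖z‖ / c) * ‖ψ p‖ = ‖ψ p‖ / c + (‖ψ p‖ + ‖z‖ * (‖ψ p‖ / c)) := by ring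
    rw [e]
    have : 0 ≤ ‖ψ p‖ / c := by positivity
    have : 0 ≤ ‖ψ p‖ + ‖z‖ * (‖ψ p‖ / c) := by positivity
    apply max_le <;> linarith
  have hcr : IsClosed (Set.range ψ) := hanti.isClosed_range ψ.uniformContinuous
  have hker : LinearMap.ker (ψ : G' →ₗ[ℂ] E) = ⊥ := LinearMap.ker_eq_bot.2 hanti.injective
  have hrange : LinearMap.range (ψ : G' →ₗ[ℂ] E) = ⊤ := by
    have hcr' : IsClosed ((LinearMap.range (ψ : G' →ₗ[ℂ] E) : Submodule ℂ E) : Set E) := by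
      rw [LinearMap.coe_range]
      exact hcr
    rw [← hcr'.submodule_topologicalClosure_eq, Submodule.topologicalClosure_eq_top_iff,
      Submodule.eq_bot_iff]
    intro y hy
    refine hd y fun p hp => ?_
    exact (Submodule.mem_orthogonal _ _).1 hy _ ⟨⟨p, G.le_topologicalClosure hp⟩, rfl⟩
  let e := ContinuousLinearEquiv.ofBijective ψ hker hrange
  let R : E →L[ℂ] E :=
    (ContinuousLinearMap.fst ℂ E E).comp (G'.subtypeL.comp (e.symm : E →L[ℂ] G'))
  have hR1 : ∀ w : E, ∃ u : T.domain, (u : E) = R w ∧ T u - z • (u : E) = w := by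
    intro w
    obtain ⟨u, hu1, hu2⟩ := (LinearPMap.mem_graph_iff T).1 (hG' (e.symm w).2)
    refine ⟨u, hu1, ?_⟩
    rw [hu1, hu2, ← hψ]
    exact e.apply_symm_apply w
  refine ⟨R, hR1, fun u => ?_⟩
  obtain ⟨u', hu1, hu2⟩ := hR1 (T u - z • (u : E))
  rw [← hu1]
  -- A priori the closure of the core is smaller than the graph of `T`; injectivity on the whole
  -- graph is what makes `R` a left inverse.
  have h := hinj ((u' - u : T.domain), T (u' - u)) (T.mem_graph _) (by
    rw [LinearPMap.map_sub]
    simp only [AddSubgroupClass.coe_sub, smul_sub]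
    rw [sub_eq_sub_iff_sub_eq_sub]; exact hu2)
  simpa [sub_eq_zero] using h

/-- The spectral criterion for an operator which is symmetric with respect to a core. -/
theorem mem_resolventSet_of_symmetric_core [CompleteSpace E] (T : E →ₗ.[ℂ] E)
    (G : Submodule ℂ (E × E)) (hT : IsClosed (T.graph : Set (E × E))) (hG : G ≤ T.graph)
    (hsymm : ∀ p ∈ T.graph, ∀ q ∈ G, ⟪q.2, p.1⟫ = ⟪q.1, p.2⟫) (z : ℂ) (c : ℝ) (hc : 0 < c)
    (hlb : ∀ p ∈ G, c * ‖p.1‖ ≤ ‖p.2 - z • p.1‖)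
    (hd : ∀ y, (∀ p ∈ G, ⟪p.2 - z • p.1, y⟫ = 0) → y = 0)
    (hd' : ∀ y, (∀ p ∈ G, ⟪p.2 - (starRingEnd ℂ z) • p.1, y⟫ = 0) → y = 0) :
    z ∈ resolventSet T := by
  -- By symmetry, an eigenvector for `z` is orthogonal to the range of `T - conj z` on the core.
  refine mem_resolventSet_of_core T G hT hG z c hc hlb hd fun p hp hpz => hd' _ fun q hq => ?_
  rw [inner_sub_left, hsymm p hp q hq, hpz, inner_smul_left, inner_smul_right]
  simp

/-- Lower bound for `T - z` on the span of eigenvectors of `T` such that the eigenvectors with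
different eigenvalues are orthogonal. -/
theorem lower_bound_of_mem_span_eigenvectors {J : Type*} (v : J → E) (μ : J → ℝ)
    (horth : ∀ j k, μ j ≠ μ k → ⟪v j, v k⟫ = 0) (z : ℂ) (c : ℝ) (hc : 0 ≤ c)
    (hμ : ∀ j, c ≤ ‖(μ j : ℂ) - z‖) (p : E × E)
    (hp : p ∈ Submodule.span ℂ (Set.range fun j => (v j, (μ j : ℂ) • v j))) :
    c * ‖p.1‖ ≤ ‖p.2 - z • p.1‖ := by
  classical
  obtain ⟨a, rfl⟩ := (Finsupp.mem_span_range_iff_exists_finsupp).1 hp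
  -- Vectors sharing an eigenvalue need not be orthogonal, so the sum is grouped by eigenvalue
  -- before Pythagoras is applied.
  let W : ℝ → Submodule ℂ E := fun t => Submodule.span ℂ (v '' {j | μ j = t})
  have hW : OrthogonalFamily ℂ (fun t => W t) fun t => (W t).subtypeₗᵢ := by
    refine OrthogonalFamily.of_pairwise fun s t hst => ?_
    refine (Submodule.isOrtho_span).2 ?_
    rintro _ ⟨j, rfl, rfl⟩ _ ⟨k, rfl, rfl⟩
    exact horth j k hst
  let l : ∀ t : ℝ, W t := fun t =>
    ⟨∑ j ∈ a.support with μ j = t, a j • v j, Submodule.sum_mem _ fun j hj =>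
      Submodule.smul_mem _ _ (Submodule.subset_span ⟨j, (Finset.mem_filter.1 hj).2, rfl⟩)⟩
  let F := a.support.image μ
  have h1 : (a.sum fun j b => b • (v j, (μ j : ℂ) • v j)).1 = ∑ t ∈ F, (W t).subtypeₗᵢ (l t) := by
    rw [Finsupp.sum, Prod.fst_sum]
    exact (Finset.sum_fiberwise_of_maps_to (fun j hj => Finset.mem_image_of_mem μ hj) _).symm
  have h2 : (a.sum fun j b => b • (v j, (μ j : ℂ) • v j)).2 =
      ∑ t ∈ F, (W t).subtypeₗᵢ ((t : ℂ) • l t) := by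
    rw [Finsupp.sum, Prod.snd_sum,
      ← Finset.sum_fiberwise_of_maps_to (fun j hj => Finset.mem_image_of_mem μ hj)]
    refine Finset.sum_congr rfl fun t _ => ?_
    rw [map_smul]
    change _ = (t : ℂ) • ∑ j ∈ a.support with μ j = t, a j • v j
    rw [Finset.smul_sum]
    refine Finset.sum_congr rfl fun j hj => ?_
    rw [← (Finset.mem_filter.1 hj).2]
    simp only [Prod.smul_snd]
    exact smul_comm _ _ _
  have h3 : (a.sum fun j b => b • (v j, (μ j : ℂ) • v j)).2 -
      z • (a.sum fun j b => b • (v j, (μ j : ℂ) • v j)).1 =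
      ∑ t ∈ F, (W t).subtypeₗᵢ (((t : ℂ) - z) • l t) := by
    rw [h1, h2, Finset.smul_sum, ← Finset.sum_sub_distrib]
    refine Finset.sum_congr rfl fun t _ => ?_
    rw [sub_smul, map_sub, map_smul _ z]
  refine le_of_sq_le_sq ?_ (norm_nonneg _)
  rw [h3, h1, mul_pow, hW.norm_sum, hW.norm_sum, Finset.mul_sum]
  refine Finset.sum_le_sum fun t ht => ?_
  obtain ⟨j, -, rfl⟩ := Finset.mem_image.1 ht
  rw [norm_smul, mul_pow]
  gcongr
  exact hμ j

end UnboundedOp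

/-! ### Operators which are block diagonal up to a bounded perturbation -/

namespace Hierarchical

local notation "⟪" x ", " y "⟫" => inner ℂ x y

section Symmetric

variable {E : Type*} [NormedAddCommGroup E] [InnerProductSpace ℂ E]

/-- Symmetry of a set of pairs extends to the closure of its span. -/
theorem inner_symm_of_mem_closure_span (s : Set (E × E))
    (h : ∀ p ∈ s, ∀ q ∈ s, ⟪q.2, p.1⟫ = ⟪q.1, p.2⟫) :
    ∀ p ∈ (Submodule.span ℂ s).topologicalClosure, ∀ q ∈ (Submodule.span ℂ s).topologicalClosure,
      ⟪q.2, p.1⟫ = ⟪q.1, p.2⟫ := by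
  let ℓ : E × E → E × E →L[ℂ] ℂ := fun q =>
    (innerSL ℂ q.2).comp (ContinuousLinearMap.fst ℂ E E) -
      (innerSL ℂ q.1).comp (ContinuousLinearMap.snd ℂ E E)
  have hℓ : ∀ p q, ℓ q p = ⟪q.2, p.1⟫ - ⟪q.1, p.2⟫ := fun p q => rfl
  have key : ∀ q : E × E, (∀ p ∈ s, ⟪q.2, p.1⟫ = ⟪q.1, p.2⟫) →
      ∀ p ∈ (Submodule.span ℂ s).topologicalClosure, ⟪q.2, p.1⟫ = ⟪q.1, p.2⟫ := by
    intro q hq p hp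
    have hle : (Submodule.span ℂ s).topologicalClosure ≤ LinearMap.ker (ℓ q : E × E →ₗ[ℂ] ℂ) := by
      refine Submodule.topologicalClosure_minimal _ (Submodule.span_le.2 fun p hp => ?_)
        (ℓ q).isClosed_ker
      change ℓ q p = 0
      rw [hℓ, hq p hp, sub_self]
    have : ℓ q p = 0 := hle hp
    rwa [hℓ, sub_eq_zero] at this
  intro p hp q hq
  -- `key` is applied once in each slot; conjugate symmetry exchanges the slots.
  refine key q (fun p' hp' => ?_) p hp
  have := key p' (fun q' hq' => h q' hq' p' hp') q hq
  rw [← inner_conj_symm, ← this, inner_conj_symm]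

end Symmetric

/-- The data of an operator `H` in a Hilbert space such that `H (v j) = (lam j + σ (blk j)) v j`
and `H (e i) = L₀ (e i) + σ i (e i)`, where the `e i` are orthonormal and orthogonal to the `v j`,
and `L₀` is bounded and symmetric and preserves the closed linear span of the `e i`. -/
structure BlockModel (E ι J : Type*) [NormedAddCommGroup E] [InnerProductSpace ℂ E] where
  /-- the orthonormal vectors -/
  e : ι → E
  /-- the eigenvectors -/
  v : J → E
  /-- the values of the potential -/
  σ : ι → ℝ
  /-- the eigenvalues of the unperturbed operator -/
  lam : J → ℝ
  /-- the block containing an eigenvector -/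
  blk : J → ι
  /-- the bounded part of the unperturbed operator -/
  L₀ : E →L[ℂ] E
  orthonormal : Orthonormal ℂ e
  v_ne_zero : ∀ j, v j ≠ 0
  inner_v_e : ∀ i j, ⟪v j, e i⟫ = 0
  inner_v_v_of_blk : ∀ j k, blk j ≠ blk k → ⟪v j, v k⟫ = 0
  inner_v_v_of_lam : ∀ j k, lam j ≠ lam k → ⟪v j, v k⟫ = 0
  symm : ∀ x y, ⟪L₀ x, y⟫ = ⟪x, L₀ y⟫
  inner_v_L₀_e : ∀ i j, ⟪v j, L₀ (e i)⟫ = 0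
  total : ∀ y, (∀ i, ⟪e i, y⟫ = 0) → (∀ j, ⟪v j, y⟫ = 0) → y = 0
  finite : ∀ i t, {j | blk j = i ∧ lam j = t}.Finite
  surj : ∀ i j, ∃ k, blk k = i ∧ lam k = lam j

namespace BlockModel

variable {E ι J : Type*} [NormedAddCommGroup E] [InnerProductSpace ℂ E] (M : BlockModel E ι J)

/-- The eigenvalues of the perturbed operator. -/
def mu (j : J) : ℝ := M.lam j + M.σ (M.blk j)

/-- The part of the graph spanned by the `e i`. -/
def cutGraph : Submodule ℂ (E × E) :=
  Submodule.span ℂ (Set.range fun i => (M.e i, M.L₀ (M.e i) + (M.σ i : ℂ) • M.e i))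

/-- The part of the graph spanned by the eigenvectors. -/
def eigGraph : Submodule ℂ (E × E) :=
  Submodule.span ℂ (Set.range fun j => (M.v j, (M.mu j : ℂ) • M.v j))

/-- The graph of the operator. -/
def graph : Submodule ℂ (E × E) := M.cutGraph ⊔ M.eigGraph

/-- The orthogonal complement of the eigenvectors. -/
def compl : Submodule ℂ E := (Submodule.span ℂ (Set.range M.v))ᗮ

theorem mem_compl_iff (y : E) : y ∈ M.compl ↔ ∀ j, ⟪M.v j, y⟫ = 0 := by
  rw [compl, Submodule.mem_orthogonal]
  constructor
  · exact fun h j => h _ (Submodule.subset_span ⟨j, rfl⟩)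
  · intro h u hu
    induction hu using Submodule.span_induction with
    | mem x hx => obtain ⟨j, rfl⟩ := hx; exact h j
    | zero => simp
    | add x y _ _ hx hy => rw [inner_add_left, hx, hy, add_zero]
    | smul a x _ hx => rw [inner_smul_left, hx, mul_zero]

theorem e_mem_compl (i : ι) : M.e i ∈ M.compl := (M.mem_compl_iff _).2 fun j => M.inner_v_e i j

/-- Inside one block the potential cancels, so the unperturbed eigenvalues differ; across blocks
orthogonality is part of the data. -/
theorem inner_v_v_of_mu (j k : J) (h : M.mu j ≠ M.mu k) : ⟪M.v j, M.v k⟫ = 0 := by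
  by_cases hb : M.blk j = M.blk k
  · refine M.inner_v_v_of_lam j k fun hl => h ?_
    rw [mu, mu, hb, hl]
  · exact M.inner_v_v_of_blk j k hb

theorem graph_eq_span : M.graph = Submodule.span ℂ
    ((Set.range fun i => (M.e i, M.L₀ (M.e i) + (M.σ i : ℂ) • M.e i)) ∪
      Set.range fun j => (M.v j, (M.mu j : ℂ) • M.v j)) := by
  rw [Submodule.span_union]; rfl

/-- It suffices to pair generators: `L₀` is symmetric and `σ`, `mu` are real, while the mixed
pairings vanish because `v j` is orthogonal to both `e i` and `L₀ (e i)`. -/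
theorem inner_symm : ∀ p ∈ M.graph.topologicalClosure, ∀ q ∈ M.graph.topologicalClosure,
    ⟪q.2, p.1⟫ = ⟪q.1, p.2⟫ := by
  classical
  rw [graph_eq_span]
  refine inner_symm_of_mem_closure_span _ ?_
  have hve : ∀ i j, ⟪M.e i, M.v j⟫ = 0 := fun i j => by
    rw [← inner_conj_symm, M.inner_v_e, map_zero]
  have hvL : ∀ i j, ⟪M.L₀ (M.e i), M.v j⟫ = 0 := fun i j => by
    rw [← inner_conj_symm, M.inner_v_L₀_e, map_zero]
  rintro _ (⟨i, rfl⟩ | ⟨i, rfl⟩) _ (⟨k, rfl⟩ | ⟨k, rfl⟩)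
  · simp only [inner_add_left, inner_add_right, inner_smul_left, inner_smul_right,
      Complex.conj_ofReal, M.symm]
    by_cases h : k = i
    · rw [h]
    · rw [M.orthonormal.2 h, mul_zero, mul_zero]
  · simp [M.inner_v_e, M.inner_v_L₀_e]
  · simp [hve, hvL]
  · simp only [inner_smul_left, inner_smul_right, Complex.conj_ofReal]
    by_cases h : M.mu k = M.mu i
    · rw [h]
    · rw [M.inner_v_v_of_mu k i h, mul_zero, mul_zero]

theorem e_mem_graph (i : ι) : (M.e i, M.L₀ (M.e i) + (M.σ i : ℂ) • M.e i) ∈ M.graph :=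
  Submodule.mem_sup_left (Submodule.subset_span ⟨i, rfl⟩)

theorem v_mem_graph (j : J) : (M.v j, (M.mu j : ℂ) • M.v j) ∈ M.graph :=
  Submodule.mem_sup_right (Submodule.subset_span ⟨j, rfl⟩)

theorem mem_compl_of_mem_cutGraph (p : E × E) (hp : p ∈ M.cutGraph) :
    p.1 ∈ M.compl ∧ p.2 ∈ M.compl := by
  have : M.cutGraph ≤ M.compl.prod M.compl := by
    refine Submodule.span_le.2 ?_
    rintro _ ⟨i, rfl⟩
    refine ⟨M.e_mem_compl i, Submodule.add_mem _ ?_ (Submodule.smul_mem _ _ (M.e_mem_compl i))⟩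
    exact (M.mem_compl_iff _).2 fun j => M.inner_v_L₀_e i j
  exact this hp

theorem mem_span_of_mem_eigGraph (p : E × E) (hp : p ∈ M.eigGraph) :
    p.1 ∈ Submodule.span ℂ (Set.range M.v) ∧ p.2 ∈ Submodule.span ℂ (Set.range M.v) := by
  have : M.eigGraph ≤ (Submodule.span ℂ (Set.range M.v)).prod
      (Submodule.span ℂ (Set.range M.v)) := by
    refine Submodule.span_le.2 ?_
    rintro _ ⟨i, rfl⟩
    exact ⟨Submodule.subset_span ⟨i, rfl⟩, Submodule.smul_mem _ _ (Submodule.subset_span ⟨i, rfl⟩)⟩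
  exact this hp

/-- The operator is densely defined. -/
theorem eq_zero_of_orthogonal_graph (y : E) (h : ∀ p ∈ M.graph, ⟪p.1, y⟫ = 0) : y = 0 :=
  M.total y (fun i => h _ (M.e_mem_graph i)) fun j => h _ (M.v_mem_graph j)

/-- The closure of the graph is a graph. -/
theorem snd_eq_zero_of_mem_closure (p : E × E) (hp : p ∈ M.graph.topologicalClosure)
    (h : p.1 = 0) : p.2 = 0 := by
  refine M.eq_zero_of_orthogonal_graph _ fun q hq => ?_
  rw [← M.inner_symm p hp q (Submodule.le_topologicalClosure _ hq), h, inner_zero_right]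

theorem conj_eq_of_eigenvector (z : ℂ) (y : E) (hy : (y, z • y) ∈ M.graph.topologicalClosure)
    (hy0 : y ≠ 0) : starRingEnd ℂ z = z := by
  have h := M.inner_symm _ hy _ hy
  simp only [inner_smul_left, inner_smul_right] at h
  exact mul_right_cancel₀ (inner_self_ne_zero.2 hy0) h

theorem inner_eq_zero_of_eigenvectors (z w : ℂ) (x y : E)
    (hx : (x, z • x) ∈ M.graph.topologicalClosure) (hy : (y, w • y) ∈ M.graph.topologicalClosure)
    (hzw : z ≠ w) : ⟪x, y⟫ = 0 := by
  rcases eq_or_ne x 0 with rfl | hx0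
  · exact inner_zero_left _
  have h := M.inner_symm _ hy _ hx
  simp only [inner_smul_left, inner_smul_right, M.conj_eq_of_eigenvector z x hx hx0] at h
  by_contra hne
  exact hzw (mul_right_cancel₀ hne h)

variable [CompleteSpace E]

/-- The expansion of the vectors orthogonal to the eigenvectors. -/
theorem hasSum_compl (y : E) (hy : y ∈ M.compl) : HasSum (fun i => ⟪M.e i, y⟫ • M.e i) y := by
  have : CompleteSpace M.compl := Submodule.instOrthogonalCompleteSpace _
  let e' : ι → M.compl := fun i => ⟨M.e i, M.e_mem_compl i⟩
  have he' : Orthonormal ℂ e' := M.orthonormal.codRestrict M.compl M.e_mem_compl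
  -- Orthogonality to the `v j` being automatic here, `total` says that the `e i` form a Hilbert
  -- basis of `compl`.
  have hbot : (Submodule.span ℂ (Set.range e'))ᗮ = ⊥ := by
    rw [Submodule.eq_bot_iff]
    intro x hx
    refine Subtype.ext (M.total x (fun i => ?_) ((M.mem_compl_iff _).1 x.2))
    exact (Submodule.mem_orthogonal _ _).1 hx (e' i) (Submodule.subset_span ⟨i, rfl⟩)
  let b := HilbertBasis.mkOfOrthogonalEqBot he' hbot
  have hb := (b.hasSum_repr ⟨y, hy⟩).mapL M.compl.subtypeL
  simpa [HilbertBasis.repr_apply_apply, b, e'] using hb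

theorem L₀_mem_compl (y : E) (hy : y ∈ M.compl) : M.L₀ y ∈ M.compl := by
  refine (M.mem_compl_iff _).2 fun j => ?_
  have h := ((M.hasSum_compl y hy).mapL M.L₀).mapL (innerSL ℂ (M.v j))
  refine h.unique ?_
  simp [M.inner_v_L₀_e, hasSum_zero]

/-- The range of `H - z` on the core is dense if the lower bound holds at `z`. -/
theorem eq_zero_of_orthogonal_range (z : ℂ) (hμ : ∀ j, (M.mu j : ℂ) ≠ z) (c : ℝ) (hc : 0 < c)
    (hlb : ∀ p ∈ M.cutGraph, c * ‖p.1‖ ≤ ‖p.2 - (starRingEnd ℂ z) • p.1‖) (y : E)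
    (hy : ∀ p ∈ M.graph, ⟪p.2 - z • p.1, y⟫ = 0) : y = 0 := by
  classical
  have hyK : y ∈ M.compl := by
    refine (M.mem_compl_iff _).2 fun j => ?_
    have h := hy _ (M.v_mem_graph j)
    simp only [← sub_smul, inner_smul_left] at h
    refine (mul_eq_zero.1 h).resolve_left fun h0 => hμ j ?_
    rwa [map_eq_zero, sub_eq_zero] at h0
  -- Coordinatewise, `y` is a weak solution of `(L₀ + σ - conj z) y = 0`; it is not known to lie in
  -- the domain.
  have hye : ∀ i, ((M.σ i : ℂ) - starRingEnd ℂ z) * ⟪M.e i, y⟫ = -⟪M.e i, M.L₀ y⟫ := by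
    intro i
    have h := hy _ (M.e_mem_graph i)
    simp only [inner_sub_left, inner_add_left, inner_smul_left, Complex.conj_ofReal, M.symm] at h
    linear_combination h
  -- Partial sums of the expansion of `y` do lie in the core. Applying the operator minus `conj z`
  -- to them gives `L₀` of a partial sum of `y` minus a partial sum of `L₀ y`, which tends to `0`;
  -- the lower bound then forces `y = 0`.
  let P : Finset ι → E × E := fun F =>
    ∑ i ∈ F, ⟪M.e i, y⟫ • (M.e i, M.L₀ (M.e i) + (M.σ i : ℂ) • M.e i)
  have hP : ∀ F, P F ∈ M.cutGraph := fun F =>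
    Submodule.sum_mem _ fun i _ => Submodule.smul_mem _ _ (Submodule.subset_span ⟨i, rfl⟩)
  have hP1 : ∀ F, (P F).1 = ∑ i ∈ F, ⟪M.e i, y⟫ • M.e i := fun F => by
    simp only [P, Prod.fst_sum, Prod.smul_fst]
  have hP2 : ∀ F, (P F).2 - (starRingEnd ℂ z) • (P F).1 =
      M.L₀ (∑ i ∈ F, ⟪M.e i, y⟫ • M.e i) - ∑ i ∈ F, ⟪M.e i, M.L₀ y⟫ • M.e i := fun F => by
    rw [hP1]
    simp only [P, Prod.snd_sum, Prod.smul_snd, Finset.smul_sum, map_sum,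
      ← Finset.sum_sub_distrib]
    refine Finset.sum_congr rfl fun i _ => ?_
    rw [map_smul, ← neg_eq_iff_eq_neg.2 (hye i)]
    module
  have h1 : Tendsto (fun F => c * ‖(P F).1‖) atTop (𝓝 (c * ‖y‖)) := by
    simp only [hP1]
    exact ((M.hasSum_compl y hyK).norm).const_mul c
  have h2 : Tendsto (fun F => ‖(P F).2 - (starRingEnd ℂ z) • (P F).1‖) atTop (𝓝 0) := by
    simp only [hP2]
    have ha : Tendsto (fun F : Finset ι => M.L₀ (∑ i ∈ F, ⟪M.e i, y⟫ • M.e i)) atTop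
        (𝓝 (M.L₀ y)) := (M.L₀.continuous.tendsto y).comp (M.hasSum_compl y hyK)
    have hb : Tendsto (fun F : Finset ι => ∑ i ∈ F, ⟪M.e i, M.L₀ y⟫ • M.e i) atTop
        (𝓝 (M.L₀ y)) := M.hasSum_compl _ (M.L₀_mem_compl y hyK)
    simpa using (ha.sub hb).norm
  have h3 : c * ‖y‖ ≤ 0 := le_of_tendsto_of_tendsto' h1 h2 fun F => hlb _ (hP F)
  have : ‖y‖ ≤ 0 := by nlinarith [norm_nonneg y]
  exact norm_le_zero_iff.1 this

omit [CompleteSpace E] in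
/-- The lower bound on the core follows from the lower bounds on both parts. -/
theorem lower_bound (z : ℂ) (c c' : ℝ) (hc : 0 < c) (hc' : 0 < c')
    (hμ : ∀ j, c' ≤ ‖(M.mu j : ℂ) - z‖)
    (hlb : ∀ p ∈ M.cutGraph, c * ‖p.1‖ ≤ ‖p.2 - z • p.1‖) :
    ∀ p ∈ M.graph, min c c' * ‖p.1‖ ≤ ‖p.2 - z • p.1‖ := by
  intro p hp
  obtain ⟨q, hq, r, hr, rfl⟩ := Submodule.mem_sup.1 hp
  have hq' := M.mem_compl_of_mem_cutGraph q hq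
  have hr' := M.mem_span_of_mem_eigGraph r hr
  have h1 := hlb q hq
  have h2 := UnboundedOp.lower_bound_of_mem_span_eigenvectors M.v M.mu M.inner_v_v_of_mu z c'
    hc'.le hμ r hr
  -- Both parts of the graph take arguments and values in orthogonal subspaces, so the squared
  -- bounds add up by Pythagoras.
  have horth : ∀ a ∈ M.compl, ∀ b ∈ Submodule.span ℂ (Set.range M.v), ⟪a, b⟫ = 0 := by
    intro a ha b hb
    rw [← inner_conj_symm, (Submodule.mem_orthogonal _ _).1 ha b hb, map_zero]
  have e1 := norm_add_sq_eq_norm_sq_add_norm_sq_of_inner_eq_zero (𝕜 := ℂ) q.1 r.1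
    (horth _ hq'.1 _ hr'.1)
  have e2 := norm_add_sq_eq_norm_sq_add_norm_sq_of_inner_eq_zero (𝕜 := ℂ) (q.2 - z • q.1)
    (r.2 - z • r.1) (horth _ (Submodule.sub_mem _ hq'.2 (Submodule.smul_mem _ _ hq'.1)) _
      (Submodule.sub_mem _ hr'.2 (Submodule.smul_mem _ _ hr'.1)))
  have e3 : (q + r).2 - z • (q + r).1 = (q.2 - z • q.1) + (r.2 - z • r.1) := by
    simp only [Prod.fst_add, Prod.snd_add, smul_add]; abel
  have h1' : min c c' * ‖q.1‖ ≤ ‖q.2 - z • q.1‖ :=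
    (mul_le_mul_of_nonneg_right (min_le_left _ _) (norm_nonneg _)).trans h1
  have h2' : min c c' * ‖r.1‖ ≤ ‖r.2 - z • r.1‖ :=
    (mul_le_mul_of_nonneg_right (min_le_right _ _) (norm_nonneg _)).trans h2
  have hm : 0 < min c c' := lt_min hc hc'
  refine le_of_sq_le_sq ?_ (norm_nonneg _)
  rw [e3, Prod.fst_add, mul_pow, sq ‖q.1 + r.1‖, e1, sq ‖_ + _‖, e2]
  have a1 := mul_self_le_mul_self (by positivity) h1'
  have a2 := mul_self_le_mul_self (by positivity) h2'
  nlinarith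

end BlockModel

end Hierarchical

/-! ### Compactness of the cut part when the potential tends to infinity -/

namespace Hierarchical

local notation "⟪" x ", " y "⟫" => inner ℂ x y

theorem norm_sq_sum_smul_orthonormal {E ι : Type*} [NormedAddCommGroup E] [InnerProductSpace ℂ E]
    {e : ι → E} (he : Orthonormal ℂ e) (a : ι → ℂ) (s : Finset ι) :
    ‖∑ i ∈ s, a i • e i‖ ^ 2 = ∑ i ∈ s, ‖a i‖ ^ 2 := by
  have h := he.inner_sum a a s
  rw [inner_self_eq_norm_sq_to_K] at h
  have h2 : ∀ i, (starRingEnd ℂ) (a i) * a i = ((‖a i‖ ^ 2 : ℝ) : ℂ) := fun i => by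
    rw [RCLike.conj_mul]; simp
  simp only [h2] at h
  refine Complex.ofReal_injective ?_
  push_cast at h ⊢
  exact h

namespace BlockModel

variable {E ι J : Type*} [NormedAddCommGroup E] [InnerProductSpace ℂ E] (M : BlockModel E ι J)

/-- Symmetry against the generator at `e i` identifies `σ i * ⟪e i, p.1⟫` with the `i`-th
coefficient of `p.2 - L₀ p.1`; then Bessel's inequality applies. -/
theorem sum_sq_le_of_mem_graph (p : E × E) (hp : p ∈ M.graph.topologicalClosure)
    (F : Finset ι) : ∑ i ∈ F, M.σ i ^ 2 * ‖⟪M.e i, p.1⟫‖ ^ 2 ≤ ‖p.2 - M.L₀ p.1‖ ^ 2 := by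
  refine le_trans (le_of_eq (Finset.sum_congr rfl fun i _ => ?_))
    (M.orthonormal.sum_inner_products_le (p.2 - M.L₀ p.1) (s := F))
  have h := M.inner_symm p hp _ (Submodule.le_topologicalClosure _ (M.e_mem_graph i))
  simp only [inner_add_left, inner_smul_left, Complex.conj_ofReal, M.symm] at h
  rw [inner_sub_right, ← h, add_sub_cancel_left, norm_mul, mul_pow, Complex.norm_real,
    Real.norm_eq_abs, sq_abs]

/-- The vectors in the complement which are bounded in the graph norm of the potential. -/
def energyBall (R : ℝ) : Set E :=
  {y | y ∈ M.compl ∧ ‖y‖ ≤ R ∧ ∀ F : Finset ι, ∑ i ∈ F, M.σ i ^ 2 * ‖⟪M.e i, y⟫‖ ^ 2 ≤ R ^ 2}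

theorem mem_energyBall (p : E × E) (hp : p ∈ M.graph.topologicalClosure) (hc : p.1 ∈ M.compl)
    (R : ℝ) (h1 : ‖p.1‖ ≤ R) (h2 : ‖p.2 - M.L₀ p.1‖ ≤ R) : p.1 ∈ M.energyBall R :=
  ⟨hc, h1, fun F => (M.sum_sq_le_of_mem_graph p hp F).trans (by gcongr)⟩

theorem mem_energyBall_of_eigenvector (z : ℂ) (y : E)
    (hp : (y, z • y) ∈ M.graph.topologicalClosure) (hc : y ∈ M.compl) (h1 : ‖y‖ = 1)
    (R : ℝ) (hR : ‖z‖ ≤ R) : y ∈ M.energyBall (R + ‖M.L₀‖ + 1) := by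
  refine M.mem_energyBall _ hp hc _ ?_ ?_
  · have := norm_nonneg M.L₀
    have := norm_nonneg z
    change ‖y‖ ≤ _
    linarith
  · change ‖z • y - M.L₀ y‖ ≤ _
    have := M.L₀.le_opNorm y
    have := norm_sub_le (z • y) (M.L₀ y)
    rw [norm_smul, h1] at this
    rw [h1] at *
    linarith

variable [CompleteSpace E]

/-- A Chebyshev estimate: off `F` the weights `σ i ^ 2` are at least `r ^ 2`, so `r ^ 2` times the
tail is dominated by the weighted sum. -/
theorem norm_sub_cut_le (R r : ℝ) (hr : 0 < r) (F : Finset ι) (hF : ∀ i ∉ F, r ≤ |M.σ i|) (y : E)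
    (hy : y ∈ M.energyBall R) : r * ‖y - ∑ i ∈ F, ⟪M.e i, y⟫ • M.e i‖ ≤ R := by
  classical
  have hR : 0 ≤ R := (norm_nonneg _).trans hy.2.1
  have h1 : Tendsto (fun G : Finset ι => r * ‖(∑ i ∈ G, ⟪M.e i, y⟫ • M.e i) -
      ∑ i ∈ F, ⟪M.e i, y⟫ • M.e i‖) atTop
      (𝓝 (r * ‖y - ∑ i ∈ F, ⟪M.e i, y⟫ • M.e i‖)) :=
    (((M.hasSum_compl y hy.1).sub_const _).norm).const_mul r
  refine le_of_tendsto h1 ?_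
  filter_upwards [eventually_ge_atTop F] with G hG
  rw [← Finset.sum_sdiff hG, add_sub_cancel_right]
  refine le_of_sq_le_sq ?_ hR
  rw [mul_pow, norm_sq_sum_smul_orthonormal M.orthonormal, Finset.mul_sum]
  refine le_trans (Finset.sum_le_sum fun i hi => ?_) (hy.2.2 (G \ F))
  have : r ^ 2 ≤ M.σ i ^ 2 := by
    rw [← sq_abs (M.σ i)]
    exact pow_le_pow_left₀ hr.le (hF i (Finset.mem_sdiff.1 hi).2) 2
  gcongr

omit [CompleteSpace E] in
theorem exists_finset_of_tendsto (hσ : Tendsto (fun i => |M.σ i|) cofinite atTop) (r : ℝ) :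
    ∃ F : Finset ι, ∀ i ∉ F, r ≤ |M.σ i| := by
  have h : {i | ¬ r ≤ |M.σ i|}.Finite := hσ.eventually_ge_atTop r
  exact ⟨h.toFinset, fun i hi => by simpa using hi⟩

/-- A Rellich-type argument: tails are uniformly small by `norm_sub_cut_le`, and the heads stay in a
bounded set of a finite-dimensional space. -/
theorem totallyBounded_energyBall (hσ : Tendsto (fun i => |M.σ i|) cofinite atTop) (R : ℝ) :
    TotallyBounded (M.energyBall R) := by
  classical
  rw [Metric.totallyBounded_iff]
  intro ε hε
  -- This threshold bounds the tail by `|R| ε / (2 (|R| + 1)) < ε / 2`; the `+ 1` keeps it positive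
  -- when `R = 0`.
  obtain ⟨F, hF⟩ := M.exists_finset_of_tendsto hσ (2 * (|R| + 1) / ε)
  have hr : 0 < 2 * (|R| + 1) / ε := by positivity
  let f : (F → ℂ) → E := fun a => ∑ i, a i • M.e i
  have hf : Continuous f := by fun_prop
  have hcomp : IsCompact (f '' Metric.closedBall 0 |R|) := (isCompact_closedBall _ _).image hf
  obtain ⟨t, ht, hcov⟩ := Metric.totallyBounded_iff.1 hcomp.totallyBounded (ε / 2) (half_pos hε)
  refine ⟨t, ht, fun y hy => ?_⟩
  have h1 := M.norm_sub_cut_le R _ hr F hF y hy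
  have h2 : f (fun i => ⟪M.e i, y⟫) = ∑ i ∈ F, ⟪M.e i, y⟫ • M.e i :=
    F.sum_coe_sort fun i => ⟪M.e i, y⟫ • M.e i
  have h3 : f (fun i => ⟪M.e i, y⟫) ∈ f '' Metric.closedBall 0 |R| := by
    refine ⟨_, ?_, rfl⟩
    rw [mem_closedBall_zero_iff]
    refine (pi_norm_le_iff_of_nonneg (abs_nonneg R)).2 fun i => ?_
    calc ‖⟪M.e i, y⟫‖ ≤ ‖M.e i‖ * ‖y‖ := norm_inner_le_norm _ _
      _ = ‖y‖ := by rw [M.orthonormal.1, one_mul]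
      _ ≤ |R| := hy.2.1.trans (le_abs_self R)
  obtain ⟨x, hx, hxy⟩ := Set.mem_iUnion₂.1 (hcov h3)
  refine Set.mem_iUnion₂.2 ⟨x, hx, ?_⟩
  rw [h2, Metric.mem_ball] at hxy
  rw [Metric.mem_ball]
  have h4 : ‖y - ∑ i ∈ F, ⟪M.e i, y⟫ • M.e i‖ < ε / 2 := by
    rw [div_mul_eq_mul_div, div_le_iff₀ hε] at h1
    have := le_abs_self R
    have h5 : 2 * (|R| + 1) * ‖y - ∑ i ∈ F, ⟪M.e i, y⟫ • M.e i‖ ≤ |R| * ε :=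
      h1.trans (by gcongr)
    by_contra hcon
    have h6 : 2 * (|R| + 1) * (ε / 2) ≤
        2 * (|R| + 1) * ‖y - ∑ i ∈ F, ⟪M.e i, y⟫ • M.e i‖ :=
      mul_le_mul_of_nonneg_left (not_lt.1 hcon) (by positivity)
    nlinarith [abs_nonneg R]
  calc dist y x ≤ dist y (∑ i ∈ F, ⟪M.e i, y⟫ • M.e i) +
        dist (∑ i ∈ F, ⟪M.e i, y⟫ • M.e i) x := dist_triangle _ _ _
    _ < ε / 2 + ε / 2 := by rw [dist_eq_norm]; exact add_lt_add h4 hxy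
    _ = ε := add_halves ε

omit [CompleteSpace E] in
theorem mem_closure_of_tendsto (p : ℕ → E × E) (x : E × E) (hp : ∀ n, p n ∈ M.graph)
    (h : Tendsto p atTop (𝓝 x)) : x ∈ M.graph.topologicalClosure :=
  _root_.mem_closure_of_tendsto h (Eventually.of_forall hp)

/-- The lower bound on the span of the `e i`, in the absence of eigenvectors. -/
theorem exists_lower_bound_cutGraph (hσ : Tendsto (fun i => |M.σ i|) cofinite atTop) (z : ℂ)
    (hz : ∀ y ∈ M.compl, (y, z • y) ∈ M.graph.topologicalClosure → y = 0) :
    ∃ c > 0, ∀ p ∈ M.cutGraph, c * ‖p.1‖ ≤ ‖p.2 - z • p.1‖ := by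
  -- Failure gives unit vectors `p n` whose images under the operator minus `z` tend to `0`.
  -- Precompactness yields a convergent subsequence, whose limit is a unit eigenvector in the
  -- complement.
  by_contra! hcon
  have hn : ∀ n : ℕ, ∃ p ∈ M.cutGraph, ‖p.1‖ = 1 ∧ ‖p.2 - z • p.1‖ ≤ 1 / ((n : ℝ) + 1) := by
    intro n
    obtain ⟨p, hp, hlt⟩ := hcon (1 / ((n : ℝ) + 1)) (by positivity)
    have hp0 : 0 < ‖p.1‖ := by
      rcases (norm_nonneg p.1).eq_or_lt with h | h
      · rw [← h, mul_zero] at hlt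
        exact absurd hlt (not_lt.2 (norm_nonneg _))
      · exact h
    have hn : ‖((‖p.1‖⁻¹ : ℝ) : ℂ)‖ = ‖p.1‖⁻¹ := by
      rw [Complex.norm_real, norm_inv, norm_norm]
    refine ⟨((‖p.1‖⁻¹ : ℝ) : ℂ) • p, Submodule.smul_mem _ _ hp, ?_, ?_⟩
    · rw [Prod.smul_fst, norm_smul, hn, inv_mul_cancel₀ hp0.ne']
    · rw [Prod.smul_fst, Prod.smul_snd, smul_comm z, ← smul_sub, norm_smul, hn,
        inv_mul_le_iff₀ hp0, mul_comm]
      exact hlt.le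
  choose p hp hp1 hp2 using hn
  have hcut : M.cutGraph ≤ M.graph := le_sup_left
  have hmem : ∀ n, (p n).1 ∈ M.energyBall (‖z‖ + ‖M.L₀‖ + 1) := by
    intro n
    refine M.mem_energyBall _ (Submodule.le_topologicalClosure _ (hcut (hp n)))
      (M.mem_compl_of_mem_cutGraph _ (hp n)).1 _ ?_ ?_
    · have := norm_nonneg M.L₀
      have := norm_nonneg z
      rw [hp1]; linarith
    · have h1 : (p n).2 - M.L₀ (p n).1 =
          ((p n).2 - z • (p n).1) + z • (p n).1 - M.L₀ (p n).1 := by abel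
      have h2 : ‖(p n).2 - z • (p n).1‖ ≤ 1 := by
        refine (hp2 n).trans ?_
        rw [div_le_one (by positivity)]
        simp
      have h3 := M.L₀.le_opNorm (p n).1
      rw [hp1, mul_one] at h3
      calc ‖(p n).2 - M.L₀ (p n).1‖ ≤ ‖(p n).2 - z • (p n).1‖ + ‖z • (p n).1‖ + ‖M.L₀ (p n).1‖ := by
            rw [h1]
            exact (norm_sub_le _ _).trans (by gcongr; exact norm_add_le _ _)
        _ ≤ 1 + ‖z‖ + ‖M.L₀‖ := by
            rw [norm_smul, hp1, mul_one]; gcongr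
        _ = _ := by ring
  have hcpt : IsCompact (closure (M.energyBall (‖z‖ + ‖M.L₀‖ + 1))) :=
    (M.totallyBounded_energyBall hσ _).closure.isCompact_of_isClosed isClosed_closure
  obtain ⟨y, -, φ, hφ, hlim⟩ := hcpt.tendsto_subseq fun n => subset_closure (hmem n)
  have hlim1 : Tendsto (fun n => (p (φ n)).1) atTop (𝓝 y) := hlim
  have hdiff : Tendsto (fun n => (p (φ n)).2 - z • (p (φ n)).1) atTop (𝓝 0) := by
    have h0 : Tendsto (fun n => (p n).2 - z • (p n).1) atTop (𝓝 0) :=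
      squeeze_zero_norm hp2 tendsto_one_div_add_atTop_nhds_zero_nat
    exact h0.comp hφ.tendsto_atTop
  have hlim2 : Tendsto (fun n => (p (φ n)).2) atTop (𝓝 (z • y)) := by
    have := hdiff.add (hlim1.const_smul z)
    simpa using this
  have hcl : (y, z • y) ∈ M.graph.topologicalClosure :=
    M.mem_closure_of_tendsto (fun n => p (φ n)) _ (fun n => hcut (hp _)) (hlim1.prodMk_nhds hlim2)
  have hyc : y ∈ M.compl :=
    (Submodule.isClosed_orthogonal _).mem_of_tendsto hlim1
      (Eventually.of_forall fun n => (M.mem_compl_of_mem_cutGraph _ (hp _)).1)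
  have hy1 : ‖y‖ = 1 :=
    tendsto_nhds_unique hlim1.norm (by simp only [hp1]; exact tendsto_const_nhds)
  rw [hz y hyc hcl, norm_zero] at hy1
  exact zero_ne_one hy1

/-- The threshold `2 * R` leaves a tail of norm at most `1 / 2`. The resulting mass on `F` is
uniform over the energy ball, which permits counting eigenvectors. -/
theorem half_le_norm_cut (R : ℝ) (hR : 0 < R) (F : Finset ι) (hF : ∀ i ∉ F, 2 * R ≤ |M.σ i|)
    (y : E) (hy : y ∈ M.energyBall R) (h1 : ‖y‖ = 1) :
    1 / 4 ≤ ∑ i ∈ F, ‖⟪M.e i, y⟫‖ ^ 2 := by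
  have h2 := M.norm_sub_cut_le R (2 * R) (by positivity) F hF y hy
  rw [← norm_sq_sum_smul_orthonormal M.orthonormal]
  have h3 : ‖y - ∑ i ∈ F, ⟪M.e i, y⟫ • M.e i‖ ≤ 1 / 2 := by
    by_contra hcon
    nlinarith
  have h4 := norm_sub_norm_le y (∑ i ∈ F, ⟪M.e i, y⟫ • M.e i)
  have h5 : 1 / 2 ≤ ‖∑ i ∈ F, ⟪M.e i, y⟫ • M.e i‖ := by linarith
  nlinarith

/-- The eigenvalues with eigenvectors in the complement. -/
def complEigenvalues : Set ℂ :=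
  {z | ∃ y ∈ M.compl, (y, z • y) ∈ M.graph.topologicalClosure ∧ ‖y‖ = 1}

omit [CompleteSpace E] in
theorem mem_complEigenvalues (z : ℂ) (y : E) (hy : y ∈ M.compl)
    (hyz : (y, z • y) ∈ M.graph.topologicalClosure) (hy0 : y ≠ 0) : z ∈ M.complEigenvalues := by
  have hn : ‖((‖y‖⁻¹ : ℝ) : ℂ)‖ = ‖y‖⁻¹ := by rw [Complex.norm_real, norm_inv, norm_norm]
  refine ⟨((‖y‖⁻¹ : ℝ) : ℂ) • y, Submodule.smul_mem _ _ hy, ?_, ?_⟩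
  · have := Submodule.smul_mem _ ((‖y‖⁻¹ : ℝ) : ℂ) hyz
    rwa [Prod.smul_mk, smul_comm] at this
  · rw [norm_smul, hn, inv_mul_cancel₀ (norm_ne_zero_iff.2 hy0)]

/-- Unit eigenvectors with distinct eigenvalues are orthonormal, and each carries mass at least `1 /
4` on the coordinates in `F`. Bessel's inequality for each `e i` bounds the total mass by the size
of `F`, so there are at most `4 * F.card` such eigenvalues. -/
theorem finite_complEigenvalues (hσ : Tendsto (fun i => |M.σ i|) cofinite atTop) (R : ℝ)
    (hR : 0 ≤ R) : (M.complEigenvalues ∩ Metric.closedBall 0 R).Finite := by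
  by_contra hinf
  set R' := R + ‖M.L₀‖ + 1
  have hR' : 0 < R' := by positivity
  obtain ⟨F, hF⟩ := M.exists_finset_of_tendsto hσ (2 * R')
  obtain ⟨t, ht, hcard⟩ := Set.Infinite.exists_subset_card_eq hinf (4 * F.card + 1)
  have hy : ∀ z : t, ∃ y ∈ M.compl, (y, (z : ℂ) • y) ∈ M.graph.topologicalClosure ∧ ‖y‖ = 1 :=
    fun z => (ht z.2).1
  choose y hyc hyg hy1 using hy
  have horth : Orthonormal ℂ y := ⟨hy1, fun z w hzw =>
    M.inner_eq_zero_of_eigenvectors z w _ _ (hyg z) (hyg w) (Subtype.coe_injective.ne hzw)⟩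
  have h1 : ∀ z : t, 1 / 4 ≤ ∑ i ∈ F, ‖⟪M.e i, y z⟫‖ ^ 2 := fun z =>
    M.half_le_norm_cut R' hR' F hF (y z) (M.mem_energyBall_of_eigenvector z _ (hyg z) (hyc z)
      (hy1 z) R (by simpa using (ht z.2).2)) (hy1 z)
  have h2 : ∀ i ∈ F, ∑ z : t, ‖⟪M.e i, y z⟫‖ ^ 2 ≤ 1 := by
    intro i _
    have := horth.sum_inner_products_le (M.e i) (s := Finset.univ)
    rw [M.orthonormal.1, one_pow] at this
    refine le_trans (le_of_eq (Finset.sum_congr rfl fun z _ => ?_)) this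
    rw [norm_inner_symm]
  have h3 : ∑ z : t, ∑ i ∈ F, ‖⟪M.e i, y z⟫‖ ^ 2 ≤ F.card := by
    rw [Finset.sum_comm]
    simpa using Finset.sum_le_sum h2
  have h4 : (t.card : ℝ) * (1 / 4) ≤ ∑ z : t, ∑ i ∈ F, ‖⟪M.e i, y z⟫‖ ^ 2 := by
    simpa using Finset.sum_le_sum (s := Finset.univ) fun z _ => h1 z
  rw [hcard] at h4
  push_cast at h4
  linarith

/-- No nonzero eigenvector can vanish on all coordinates in `F`, so the space embeds into `F → ℂ`.
-/
theorem finiteDimensional_of_le_compl (hσ : Tendsto (fun i => |M.σ i|) cofinite atTop) (z : ℂ)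
    (U : Submodule ℂ E) (hU : ∀ y ∈ U, y ∈ M.compl ∧ (y, z • y) ∈ M.graph.topologicalClosure) :
    FiniteDimensional ℂ U := by
  set R' := ‖z‖ + ‖M.L₀‖ + 1
  have hR' : 0 < R' := by positivity
  obtain ⟨F, hF⟩ := M.exists_finset_of_tendsto hσ (2 * R')
  let f : U →ₗ[ℂ] (F → ℂ) := LinearMap.pi fun i => (innerₛₗ ℂ (M.e i)).comp U.subtype
  have hf : ∀ y i, f y i = ⟪M.e i, (y : E)⟫ := fun y i => rfl
  have hinj : Function.Injective f := by
    rw [← LinearMap.ker_eq_bot, LinearMap.ker_eq_bot']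
    intro y hy
    by_contra hne
    have hy0 : (y : E) ≠ 0 := fun h => hne (Subtype.ext h)
    have hn : ‖((‖(y : E)‖⁻¹ : ℝ) : ℂ)‖ = ‖(y : E)‖⁻¹ := by
      rw [Complex.norm_real, norm_inv, norm_norm]
    let x : U := ((‖(y : E)‖⁻¹ : ℝ) : ℂ) • y
    have hx1 : ‖(x : E)‖ = 1 := by
      change ‖((‖(y : E)‖⁻¹ : ℝ) : ℂ) • (y : E)‖ = 1
      rw [norm_smul, hn, inv_mul_cancel₀ (norm_ne_zero_iff.2 hy0)]
    have hfx : f x = 0 := by simp only [x, map_smul, hy, smul_zero]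
    have h := M.half_le_norm_cut R' hR' F hF x (M.mem_energyBall_of_eigenvector z _
      (hU x x.2).2 (hU x x.2).1 hx1 _ le_rfl) hx1
    have h0 : ∑ i ∈ F, ‖⟪M.e i, (x : E)⟫‖ ^ 2 = 0 := by
      refine Finset.sum_eq_zero fun i hi => ?_
      rw [← hf x ⟨i, hi⟩, hfx]
      simp
    rw [h0] at h
    norm_num at h
  exact Module.Finite.of_injective f hinj

end BlockModel

end Hierarchical

/-! ### Accumulation points and the spectrum of a block model -/

namespace Hierarchical

local notation "⟪" x ", " y "⟫" => inner ℂ x y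

open UnboundedOp

theorem finite_inter_closedBall_of_noAccPts {S : Set ℂ} (hS : NoAccPts S) (R : ℝ) :
    (S ∩ Metric.closedBall 0 R).Finite := by
  by_contra hinf
  obtain ⟨z, -, hz⟩ := Set.Infinite.exists_accPt_of_subset_isCompact hinf
    (isCompact_closedBall (0 : ℂ) R) Set.inter_subset_right
  exact hS z (hz.mono (principal_mono.2 Set.inter_subset_left))

theorem noAccPts_of_finite_inter_closedBall {S : Set ℂ}
    (hS : ∀ R : ℝ, 0 ≤ R → (S ∩ Metric.closedBall 0 R).Finite) : NoAccPts S := by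
  intro z hz
  have hfin : (S ∩ Metric.closedBall 0 (‖z‖ + 1)).Finite := hS _ (by positivity)
  rw [accPt_iff_frequently_nhdsNE] at hz
  have h1 : ∀ᶠ w in 𝓝[≠] z, w ∈ Metric.closedBall (0 : ℂ) (‖z‖ + 1) := by
    refine eventually_nhdsWithin_of_eventually_nhds ?_
    filter_upwards [Metric.ball_mem_nhds z one_pos] with w hw
    rw [mem_closedBall_zero_iff]
    rw [Metric.mem_ball, dist_eq_norm] at hw
    linarith [norm_le_norm_add_norm_sub' w z]
  have h2 : ∀ᶠ w in 𝓝[≠] z, w ∉ S ∩ Metric.closedBall 0 (‖z‖ + 1) := by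
    have hfin' := hfin.subset (Set.sdiff_subset (t := {z}))
    filter_upwards [eventually_nhdsWithin_of_eventually_nhds
      (hfin'.isClosed.isOpen_compl.mem_nhds fun h => h.2 rfl), self_mem_nhdsWithin] with w hw hwz hwS
    exact hw ⟨hwS, hwz⟩
  obtain ⟨w, hw, hw1, hw2⟩ := (hz.and_eventually (h1.and h2)).exists
  exact hw2 ⟨hw, hw1⟩

theorem _root_.UnboundedOp.NoAccPts.mono {S T : Set ℂ} (hT : NoAccPts T) (h : S ⊆ T) : NoAccPts S :=
  fun z hz => hT z (hz.mono (principal_mono.2 h))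

theorem _root_.UnboundedOp.NoAccPts.union {S T : Set ℂ} (hS : NoAccPts S) (hT : NoAccPts T) : NoAccPts (S ∪ T) := by
  intro z hz
  rw [← sup_principal, accPt_sup] at hz
  exact hz.elim (hS z) (hT z)

theorem _root_.UnboundedOp.NoAccPts.isClosed {S : Set ℂ} (hS : NoAccPts S) : IsClosed S :=
  isClosed_iff_accPt.2 fun z hz => absurd hz (hS z)

theorem _root_.UnboundedOp.NoAccPts.of_add {S R : Set ℂ} (h : NoAccPts (S + R)) (r : ℂ) (hr : r ∈ R) :
    NoAccPts S := by
  refine noAccPts_of_finite_inter_closedBall fun ρ _ => ?_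
  refine Set.Finite.of_finite_image (f := (· + r)) ?_ (add_left_injective r).injOn
  refine (finite_inter_closedBall_of_noAccPts h (ρ + ‖r‖)).subset ?_
  rintro _ ⟨s, ⟨hs, hsρ⟩, rfl⟩
  refine ⟨Set.add_mem_add hs hr, ?_⟩
  rw [mem_closedBall_zero_iff] at hsρ ⊢
  exact (norm_add_le _ _).trans (by gcongr)

namespace BlockModel

variable {E ι J : Type*} [NormedAddCommGroup E] [InnerProductSpace ℂ E] (M : BlockModel E ι J)
  (H : E →ₗ.[ℂ] E) (hH : H.graph = M.graph.topologicalClosure)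

/-- The set of eigenvalues of the vectors `v j`. -/
def muRange : Set ℂ := Set.range fun j => (M.mu j : ℂ)

/-- The range of the potential. -/
def sigmaRange : Set ℂ := Set.range fun i => (M.σ i : ℂ)

/-- The set of eigenvalues of the unperturbed operator. -/
def lamRange : Set ℂ := Set.range fun j => (M.lam j : ℂ)

/-- Every sum is realised because each unperturbed eigenvalue occurs in every block (`surj`). -/
theorem lamRange_add_sigmaRange : M.lamRange + M.sigmaRange = M.muRange := by
  ext z
  constructor
  · rintro ⟨_, ⟨j, rfl⟩, _, ⟨i, rfl⟩, rfl⟩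
    obtain ⟨k, hk1, hk2⟩ := M.surj i j
    exact ⟨k, by simp [mu, hk1, hk2]⟩
  · rintro ⟨j, rfl⟩
    exact ⟨_, ⟨j, rfl⟩, _, ⟨M.blk j, rfl⟩, by simp [mu]⟩

theorem add_subset_closure (S : Set ℂ) (hS : S ⊆ closure M.lamRange) :
    S + M.sigmaRange ⊆ closure M.muRange := by
  rw [← M.lamRange_add_sigmaRange]
  rintro _ ⟨s, hs, r, hr, rfl⟩
  exact map_mem_closure (f := (· + r)) (by fun_prop) (hS hs) fun x hx => Set.add_mem_add hx hr

theorem muRange_subset_add (S : Set ℂ) (hS : M.lamRange ⊆ S) : M.muRange ⊆ S + M.sigmaRange := by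
  rw [← M.lamRange_add_sigmaRange]
  exact Set.add_subset_add_right hS

include hH

theorem closure_muRange_subset_spec : closure M.muRange ⊆ spec H := by
  intro z hz
  refine mem_spec_of_mem_closure H M.muRange ?_ z hz
  rintro _ ⟨j, rfl⟩
  refine ⟨M.v j, ?_, M.v_ne_zero j⟩
  rw [mem_eigenspace_iff_mem_graph, hH]
  exact Submodule.le_topologicalClosure _ (M.v_mem_graph j)

theorem v_mem_eigenspace (j : J) (z : ℂ) (h : (M.mu j : ℂ) = z) : M.v j ∈ eigenspace H z := by
  rw [mem_eigenspace_iff_mem_graph, hH, ← h]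
  exact Submodule.le_topologicalClosure _ (M.v_mem_graph j)

/-- Infinitely many blocks cannot contribute to an eigenspace of finite dimension. -/
theorem finite_blk_of_finiteDimensional (z : ℂ) (hz : FiniteDimensional ℂ (eigenspace H z)) :
    {i | ∃ j, M.blk j = i ∧ (M.mu j : ℂ) = z}.Finite := by
  choose j hj using fun i : {i | ∃ j, M.blk j = i ∧ (M.mu j : ℂ) = z} => i.2
  let w : {i | ∃ j, M.blk j = i ∧ (M.mu j : ℂ) = z} → eigenspace H z := fun i =>
    ⟨M.v (j i), M.v_mem_eigenspace H hH _ z (hj i).2⟩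
  have hw : LinearIndependent ℂ w := by
    refine linearIndependent_of_ne_zero_of_inner_eq_zero
      (fun i h => M.v_ne_zero _ (congrArg Subtype.val h)) fun i k hik => ?_
    refine M.inner_v_v_of_blk _ _ ?_
    rw [(hj i).1, (hj k).1]
    exact Subtype.coe_injective.ne hik
  have := hw.finite_of_isNoetherian
  exact Set.toFinite _

variable [CompleteSpace E]

/-- Outside these sets the eigenvector part is bounded below by the distance to the `mu j` and the
cut part by compactness. Density of the range needs the cut bound at `conj z` as well; it is
available because eigenvalues are real. -/
theorem spec_subset (hσ : Tendsto (fun i => |M.σ i|) cofinite atTop) :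
    spec H ⊆ closure M.muRange ∪ M.complEigenvalues := by
  intro z hz
  by_contra hcon
  rw [Set.mem_union, not_or] at hcon
  obtain ⟨hz1, hz2⟩ := hcon
  refine hz ?_
  obtain ⟨c', hc', hdist⟩ : ∃ c > 0, ∀ j, c ≤ ‖(M.mu j : ℂ) - z‖ := by
    rw [Metric.mem_closure_iff] at hz1
    push Not at hz1
    obtain ⟨c, hc, h⟩ := hz1
    exact ⟨c, hc, fun j => by rw [← dist_eq_norm, dist_comm]; exact h _ ⟨j, rfl⟩⟩
  have hno : ∀ y ∈ M.compl, (y, z • y) ∈ M.graph.topologicalClosure → y = 0 := fun y hy hyz => by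
    by_contra hne
    exact hz2 (M.mem_complEigenvalues z y hy hyz hne)
  have hno' : ∀ y ∈ M.compl, (y, (starRingEnd ℂ z) • y) ∈ M.graph.topologicalClosure →
      y = 0 := fun y hy hyz => by
    by_contra hne
    have h := M.conj_eq_of_eigenvector _ y hyz hne
    rw [Complex.conj_conj] at h
    rw [← h] at hyz
    exact hne (hno y hy hyz)
  obtain ⟨c, hc, hlb⟩ := M.exists_lower_bound_cutGraph hσ z hno
  obtain ⟨c₁, hc₁, hlb₁⟩ := M.exists_lower_bound_cutGraph hσ _ hno'
  have hne : ∀ j, (M.mu j : ℂ) ≠ z := fun j h => by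
    have := hdist j
    rw [h, sub_self, norm_zero] at this
    linarith
  refine mem_resolventSet_of_symmetric_core H M.graph ?_ ?_ ?_ z (min c c') (lt_min hc hc')
    (M.lower_bound z c c' hc hc' hdist hlb) (M.eq_zero_of_orthogonal_range z hne c₁ hc₁ hlb₁)
    (M.eq_zero_of_orthogonal_range _ (fun j h => hne j ?_) c hc ?_)
  · rw [hH]; exact M.graph.isClosed_topologicalClosure
  · rw [hH]; exact M.graph.le_topologicalClosure
  · intro p hp q hq
    rw [hH] at hp
    exact M.inner_symm p hp q (M.graph.le_topologicalClosure hq)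
  · rw [← Complex.conj_conj z, ← h, Complex.conj_ofReal]
  · rwa [Complex.conj_conj]

/-- If finitely many of the `v j` are in an eigenspace, then it is finite-dimensional. -/
theorem finiteDimensional_eigenspace (hσ : Tendsto (fun i => |M.σ i|) cofinite atTop) (z : ℂ)
    (hfin : {j | (M.mu j : ℂ) = z}.Finite) : FiniteDimensional ℂ (eigenspace H z) := by
  let N : Submodule ℂ E := Submodule.span ℂ (M.v '' {j | (M.mu j : ℂ) = z})
  have hN : FiniteDimensional ℂ N := FiniteDimensional.span_of_finite ℂ (hfin.image _)
  have hNle : N ≤ eigenspace H z := Submodule.span_le.2 (by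
    rintro _ ⟨j, hj, rfl⟩
    exact M.v_mem_eigenspace H hH j z hj)
  have hU : FiniteDimensional ℂ ↥(M.compl ⊓ eigenspace H z) :=
    M.finiteDimensional_of_le_compl hσ z _ fun y hy => ⟨hy.1, hH ▸ hy.2⟩
  -- After subtracting the projection onto `N`, what remains is orthogonal to the `v j` with
  -- eigenvalue `z` by construction, and to the others because their eigenvalues differ.
  have hle : eigenspace H z ≤ N ⊔ (M.compl ⊓ eigenspace H z) := by
    intro u hu
    rw [show u = N.starProjection u + (u - N.starProjection u) by abel]
    have hPN : N.starProjection u ∈ N := N.starProjection_apply_mem u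
    refine Submodule.add_mem_sup hPN ⟨?_, Submodule.sub_mem _ hu (hNle hPN)⟩
    refine (M.mem_compl_iff _).2 fun j => ?_
    by_cases hj : (M.mu j : ℂ) = z
    · rw [← inner_conj_symm, N.starProjection_inner_eq_zero u _
        (Submodule.subset_span ⟨j, hj, rfl⟩), map_zero]
    · have h : ∀ x ∈ eigenspace H z, ⟪M.v j, x⟫ = 0 := fun x hx =>
        M.inner_eq_zero_of_eigenvectors _ z _ _
          (M.graph.le_topologicalClosure (M.v_mem_graph j)) (hH ▸ hx) hj
      rw [inner_sub_right, h u hu, h _ (hNle hPN), sub_zero]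
  exact Submodule.finiteDimensional_of_le hle

/-- The characterization of discreteness of the spectrum. -/
theorem spectrum_dichotomy [Nonempty ι] [Nonempty J] (S : Set ℂ) (hS1 : M.lamRange ⊆ S)
    (hS2 : S ⊆ closure M.lamRange) :
    (HasDiscreteSpectrum H → Tendsto (fun i => |M.σ i|) cofinite atTop) ∧
    (Tendsto (fun i => |M.σ i|) cofinite atTop →
      (NoAccPts (spec H) ↔ NoAccPts (S + M.sigmaRange)) ∧
      (HasDiscreteSpectrum H ↔ NoAccPts (S + M.sigmaRange) ∧
        ∀ z : ℂ, {p : ℂ × ℂ | p.1 ∈ S ∧ p.2 ∈ M.sigmaRange ∧ p.1 + p.2 = z}.Finite)) := by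
  have hSR : S + M.sigmaRange ⊆ spec H :=
    (M.add_subset_closure S hS2).trans (M.closure_muRange_subset_spec H hH)
  have hμS := M.muRange_subset_add S hS1
  have hacc : HasDiscreteSpectrum H → NoAccPts (S + M.sigmaRange) := by
    intro hd z hz
    -- The accumulation point itself has to be in the spectrum, since isolation is only assumed at
    -- spectral points.
    have hzs : z ∈ spec H := by
      refine M.closure_muRange_subset_spec H hH ?_
      exact closure_minimal (M.add_subset_closure S hS2) isClosed_closure
        (mem_closure_iff_clusterPt.2 hz.clusterPt)
    exact (hd z hzs).1 (hz.mono (principal_mono.2 hSR))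
  have hnosp : Tendsto (fun i => |M.σ i|) cofinite atTop → NoAccPts (S + M.sigmaRange) →
      spec H ⊆ M.muRange ∪ M.complEigenvalues := by
    intro hσ hno
    have := M.spec_subset H hH hσ
    rwa [(hno.mono hμS).isClosed.closure_eq] at this
  have hnoacc : Tendsto (fun i => |M.σ i|) cofinite atTop → NoAccPts (S + M.sigmaRange) →
      NoAccPts (spec H) := fun hσ hno =>
    ((hno.mono hμS).union (noAccPts_of_finite_inter_closedBall
      fun R hR => M.finite_complEigenvalues hσ R hR)).mono (hnosp hσ hno)
  refine ⟨fun hd => ?_, fun hσ => ⟨⟨fun h => h.mono hSR, hnoacc hσ⟩, fun hd => ⟨hacc hd, ?_⟩, ?_⟩⟩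
  · -- finiteness of the sublevel sets of the potential
    obtain ⟨j₀⟩ := ‹Nonempty J›
    refine tendsto_atTop.2 fun b => ?_
    have hμ : NoAccPts M.muRange := (hacc hd).mono hμS
    change {i | ¬ b ≤ |M.σ i|}.Finite
    -- One fixed unperturbed eigenvalue is followed through all blocks. On a sublevel set `f` takes
    -- finitely many values, as they are bounded and do not accumulate; each fibre is finite because
    -- every block in it adds an eigenvector to one finite-dimensional eigenspace.
    let f : ι → ℂ := fun i => (M.lam j₀ : ℂ) + (M.σ i : ℂ)
    refine Set.Finite.of_finite_fibers f ?_ ?_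
    · refine (finite_inter_closedBall_of_noAccPts hμ (|M.lam j₀| + |b|)).subset ?_
      rintro _ ⟨i, hi, rfl⟩
      refine ⟨?_, ?_⟩
      · rw [← M.lamRange_add_sigmaRange]
        exact Set.add_mem_add ⟨j₀, rfl⟩ ⟨i, rfl⟩
      · rw [mem_closedBall_zero_iff]
        refine (norm_add_le _ _).trans ?_
        rw [Complex.norm_real, Complex.norm_real, Real.norm_eq_abs, Real.norm_eq_abs]
        have := (not_le.1 hi).le.trans (le_abs_self b)
        gcongr
    · rintro _ ⟨i, -, rfl⟩
      have hex : f i ∈ spec H := by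
        refine M.closure_muRange_subset_spec H hH (subset_closure ?_)
        rw [← M.lamRange_add_sigmaRange]
        exact Set.add_mem_add ⟨j₀, rfl⟩ ⟨i, rfl⟩
      refine (M.finite_blk_of_finiteDimensional H hH _ (hd _ hex).2.2).subset ?_
      rintro k ⟨-, hk⟩
      obtain ⟨l, hl1, hl2⟩ := M.surj k j₀
      refine ⟨l, hl1, ?_⟩
      rw [← show f k = f i from hk]
      simp [f, mu, hl1, hl2]
  · intro z
    obtain ⟨i₀⟩ := ‹Nonempty ι›
    -- Without accumulation points `lamRange` is closed, so the sandwich collapses and every `s ∈ S`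
    -- comes from an eigenvector in each block.
    have hlam : S ⊆ M.lamRange := by
      have hS : NoAccPts S := (hacc hd).of_add _ ⟨i₀, rfl⟩
      rwa [(hS.mono hS1).isClosed.closure_eq] at hS2
    by_cases hz : z ∈ spec H
    · refine ((M.finite_blk_of_finiteDimensional H hH z (hd z hz).2.2).image
        fun i => (z - (M.σ i : ℂ), (M.σ i : ℂ))).subset ?_
      rintro ⟨s, r⟩ ⟨hs, ⟨i, rfl⟩, rfl⟩
      obtain ⟨j, rfl⟩ := hlam hs
      obtain ⟨k, hk1, hk2⟩ := M.surj i j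
      exact ⟨i, ⟨k, hk1, by simp [mu, hk1, hk2]⟩, by simp⟩
    · refine Set.Finite.subset Set.finite_empty ?_
      rintro ⟨s, r⟩ ⟨hs, hr, rfl⟩
      exact hz (hSR (Set.add_mem_add hs hr))
  · rintro ⟨hno, hfin⟩ z hz
    -- Three finiteness facts combine: finitely many pairs `(s, r)`, finitely many blocks with a
    -- given `r` as `|σ| → ∞`, and finitely many `j` for a given block and `lam`.
    have hfinμ : {j | (M.mu j : ℂ) = z}.Finite := by
      have h1 : {p : ι × ℝ | ((p.2 : ℂ), (M.σ p.1 : ℂ)) ∈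
          {p : ℂ × ℂ | p.1 ∈ S ∧ p.2 ∈ M.sigmaRange ∧ p.1 + p.2 = z}}.Finite := by
        refine (hfin z).preimage' fun b _ => ?_
        have h2 : {i | M.σ i = b.2.re}.Finite := by
          -- The `+ 1` puts the indices with `|M.σ i| = |b.2.re|` inside the sublevel set.
          have h3 : {i | ¬ |b.2.re| + 1 ≤ |M.σ i|}.Finite := hσ.eventually_ge_atTop _
          refine h3.subset fun i (hi : M.σ i = b.2.re) => ?_
          simp [hi]
        refine (h2.prod (Set.finite_singleton b.1.re)).subset ?_
        rintro ⟨i, t⟩ rfl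
        exact ⟨by simp, by simp⟩
      refine Set.Finite.of_finite_fibers (fun j => (M.blk j, M.lam j)) (h1.subset ?_) ?_
      · rintro _ ⟨j, hj, rfl⟩
        exact ⟨hS1 ⟨j, rfl⟩, ⟨M.blk j, rfl⟩, by rw [← hj]; simp [mu]⟩
      · rintro ⟨i, t⟩ -
        refine (M.finite i t).subset ?_
        rintro j ⟨-, hj⟩
        exact ⟨congrArg Prod.fst hj, congrArg Prod.snd hj⟩
    refine ⟨hnoacc hσ hno z, ?_, M.finiteDimensional_eigenspace H hH hσ z hfinμ⟩
    rw [Submodule.ne_bot_iff]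
    rcases hnosp hσ hno hz with ⟨j, hj⟩ | ⟨y, -, hy, hy1⟩
    · exact ⟨M.v j, M.v_mem_eigenspace H hH j z hj, M.v_ne_zero j⟩
    · refine ⟨y, ?_, fun h => ?_⟩
      · rw [mem_eigenspace_iff_mem_graph, hH]; exact hy
      · rw [h, norm_zero] at hy1
        exact zero_ne_one hy1

end BlockModel

end Hierarchical

/-! ### Balls in homogeneous ultrametric spaces -/

namespace Hierarchical

variable {X : Type*} [MetricSpace X]

theorem isBall_closedBall (x : X) {r : ℝ} (hr : 0 < r) : IsBall (Metric.closedBall x r) :=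
  ⟨x, r, hr, rfl⟩

theorem IsBall.nonempty {B : Set X} (hB : IsBall B) : B.Nonempty := by
  obtain ⟨x, r, hr, rfl⟩ := hB
  exact ⟨x, Metric.mem_closedBall_self hr.le⟩

theorem IsBall.isBounded {B : Set X} (hB : IsBall B) : Bornology.IsBounded B := by
  obtain ⟨x, r, hr, rfl⟩ := hB
  exact Metric.isBounded_closedBall

theorem IsBall.isClosed {B : Set X} (hB : IsBall B) : IsClosed B := by
  obtain ⟨x, r, hr, rfl⟩ := hB
  exact Metric.isClosed_closedBall

theorem IsBall.isCompact [ProperSpace X] {B : Set X} (hB : IsBall B) : IsCompact B := by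
  obtain ⟨x, r, hr, rfl⟩ := hB
  exact isCompact_closedBall x r

theorem IsBall.image {B : Set X} (hB : IsBall B) (e : X ≃ᵢ X) : IsBall (e '' B) := by
  obtain ⟨x, r, hr, rfl⟩ := hB
  rw [e.image_closedBall]
  exact isBall_closedBall _ hr

theorem IsBall.diam_pos [PerfectSpace X] {B : Set X} (hB : IsBall B) : 0 < Metric.diam B := by
  have hb := hB.isBounded
  obtain ⟨x, r, hr, rfl⟩ := hB
  have h1 : ∀ᶠ y in 𝓝[≠] x, y ∈ Metric.closedBall x r :=
    eventually_nhdsWithin_of_eventually_nhds (Metric.closedBall_mem_nhds x hr)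
  have hne : (𝓝[≠] x).NeBot := by
    have := PerfectSpace.univ_preperfect x (Set.mem_univ x)
    rwa [AccPt, principal_univ, inf_top_eq] at this
  obtain ⟨y, hy, hyx⟩ := (h1.and self_mem_nhdsWithin).exists
  exact (dist_pos.2 hyx).trans_le
    (Metric.dist_le_diam_of_mem hb hy (Metric.mem_closedBall_self hr.le))

section Ultrametric

variable [IsUltrametricDist X]

theorem IsBall.isOpen {B : Set X} (hB : IsBall B) : IsOpen B := by
  obtain ⟨x, r, hr, rfl⟩ := hB
  exact IsUltrametricDist.isOpen_closedBall x hr.ne'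

/-- Every point of an ultrametric ball is a centre, and the radius can be taken to be the diameter.
Balls through a common point are thereby compared through their diameters alone. -/
theorem IsBall.eq_closedBall {B : Set X} (hB : IsBall B) {x : X} (hx : x ∈ B) :
    B = Metric.closedBall x (Metric.diam B) := by
  refine Set.Subset.antisymm (fun y hy => Metric.dist_le_diam_of_mem hB.isBounded hy hx) ?_
  have hb := hB.isBounded
  obtain ⟨x₀, r, hr, rfl⟩ := hB
  have h1 : Metric.diam (Metric.closedBall x₀ r) ≤ r := by
    refine Metric.diam_le_of_forall_dist_le hr.le fun y hy z hz => ?_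
    rw [IsUltrametricDist.closedBall_eq_of_mem hz] at hy
    exact hy
  rw [IsUltrametricDist.closedBall_eq_of_mem hx] at h1 ⊢
  exact Metric.closedBall_subset_closedBall h1

theorem IsBall.subset_of_diam_le {B B' : Set X} (hB : IsBall B) (hB' : IsBall B') {x : X}
    (hx : x ∈ B) (hx' : x ∈ B') (h : Metric.diam B ≤ Metric.diam B') : B ⊆ B' := by
  rw [hB.eq_closedBall hx, hB'.eq_closedBall hx']
  exact Metric.closedBall_subset_closedBall h

theorem IsBall.eq_of_diam_eq {B B' : Set X} (hB : IsBall B) (hB' : IsBall B') {x : X}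
    (hx : x ∈ B) (hx' : x ∈ B') (h : Metric.diam B = Metric.diam B') : B = B' := by
  rw [hB.eq_closedBall hx, hB'.eq_closedBall hx', h]

theorem IsBall.subset_or_subset {B B' : Set X} (hB : IsBall B) (hB' : IsBall B') {x : X}
    (hx : x ∈ B) (hx' : x ∈ B') : B ⊆ B' ∨ B' ⊆ B :=
  (le_total (Metric.diam B) (Metric.diam B')).imp (hB.subset_of_diam_le hB' hx hx')
    (hB'.subset_of_diam_le hB hx' hx)

omit [IsUltrametricDist X] in
theorem IsBall.diam_mono {B B' : Set X} (hB' : IsBall B') (h : B ⊆ B') :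
    Metric.diam B ≤ Metric.diam B' := Metric.diam_mono h hB'.isBounded

theorem IsBall.diam_lt {B B' : Set X} (hB : IsBall B) (hB' : IsBall B') (h : B ⊂ B') :
    Metric.diam B < Metric.diam B' := by
  refine lt_of_le_of_ne (hB'.diam_mono h.1) fun he => ?_
  obtain ⟨x, hx⟩ := hB.nonempty
  exact h.ne (hB.eq_of_diam_eq hB' hx (h.1 hx) he)

/-- A compact set contains finitely many balls whose diameters are bounded from below. -/
theorem finite_balls_subset {K : Set X} (hK : IsCompact K) {δ : ℝ} (hδ : 0 < δ) :
    {B : Set X | IsBall B ∧ B ⊆ K ∧ δ ≤ Metric.diam B}.Finite := by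
  obtain ⟨t, -, ht, hcov⟩ := hK.finite_cover_balls hδ
  refine Set.Finite.of_finite_image (f := fun B => B ∩ t)
    (ht.powerset.subset ?_) ?_
  · rintro _ ⟨B, -, rfl⟩
    exact Set.inter_subset_right
  -- The trace on the finite `δ`-net `t` determines the ball: a point of `B` lies within `δ ≤ diam
  -- B` of a net point, which therefore belongs to `B` too.
  · have key : ∀ B ∈ {B : Set X | IsBall B ∧ B ⊆ K ∧ δ ≤ Metric.diam B},
        ∀ B' ∈ {B : Set X | IsBall B ∧ B ⊆ K ∧ δ ≤ Metric.diam B}, B ∩ t = B' ∩ t → B ⊆ B' := by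
      rintro B ⟨hB, hBK, hBδ⟩ B' ⟨hB', -, hB'δ⟩ heq y hy
      obtain ⟨x, hx, hxy⟩ := Set.mem_iUnion₂.1 (hcov (hBK hy))
      have hxB : x ∈ B ∩ t := by
        refine ⟨?_, hx⟩
        rw [hB.eq_closedBall hy, Metric.mem_closedBall']
        exact (Metric.mem_ball.1 hxy).le.trans hBδ
      rw [heq] at hxB
      rw [hB'.eq_closedBall hxB.1]
      exact (Metric.mem_ball.1 hxy).le.trans hB'δ
    intro B hB B' hB' heq
    exact Set.Subset.antisymm (key B hB B' hB' heq) (key B' hB' B hB heq.symm)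

theorem IsParent.subset_of_ssubset {T T' B : Set X} (h : IsParent T T') (hB : IsBall B)
    (hTB : T ⊂ B) : T' ⊆ B := by
  obtain ⟨hT, hT', hTT', hmin⟩ := h
  obtain ⟨x, hx⟩ := hT.nonempty
  rcases hT'.subset_or_subset hB (hTT'.1 hx) (hTB.1 hx) with h | h
  · exact h
  · rcases hmin B hB hTB.1 h with h | h
    · exact absurd h hTB.ne'
    · exact h.ge

/-- Children of the same ball coincide or are disjoint. -/
theorem IsParent.eq_of_mem {T S T' : Set X} (h : IsParent T T') (h' : IsParent S T') {x : X}
    (hx : x ∈ T) (hx' : x ∈ S) : T = S := by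
  rcases h.1.subset_or_subset h'.1 hx hx' with hs | hs
  · rcases h.2.2.2 S h'.1 hs h'.2.2.1.1 with h1 | h1
    · exact h1.symm
    · exact absurd h1 h'.2.2.1.ne
  · rcases h'.2.2.2 T h.1 hs h.2.2.1.1 with h1 | h1
    · exact h1
    · exact absurd h1 h.2.2.1.ne

/-- A proper subball of `T'` is contained in a given child of `T'` or disjoint from it. -/
theorem IsParent.subset_or_disjoint {T T' B : Set X} (h : IsParent T T') (hB : IsBall B)
    (hBT : B ⊂ T') : B ⊆ T ∨ Disjoint B T := by
  by_cases hd : Disjoint B T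
  · exact Or.inr hd
  · obtain ⟨x, hxB, hxT⟩ := Set.not_disjoint_iff.1 hd
    rcases hB.subset_or_subset h.1 hxB hxT with hs | hs
    · exact Or.inl hs
    · rcases h.2.2.2 B hB hs hBT.1 with h1 | h1
      · exact Or.inl h1.le
      · exact absurd h1 hBT.ne

omit [IsUltrametricDist X] in
theorem IsParent.image {T T' : Set X} (h : IsParent T T') (e : X ≃ᵢ X) :
    IsParent (e '' T) (e '' T') := by
  obtain ⟨hT, hT', hTT', hmin⟩ := h
  refine ⟨hT.image e, hT'.image e, e.injective.image_strictMono hTT', ?_⟩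
  intro S hS h1 h2
  have hS' : e '' (e.symm '' S) = S := by
    rw [← Set.image_comp]; simp
  have hsub : ∀ U : Set X, e.symm '' (e '' U) = U := fun U => by
    rw [← Set.image_comp]; simp
  have h1' := Set.image_mono (f := e.symm) h1
  have h2' := Set.image_mono (f := e.symm) h2
  rw [hsub] at h1' h2'
  rcases hmin _ (hS.image e.symm) h1' h2' with h | h
  · left; rw [← hS', h]
  · right; rw [← hS', h]

/-- Noncompactness supplies a strictly larger ball, and only finitely many balls lie between it and
`T`, since their diameters are at least `diam T > 0`; the one of smallest diameter is the parent. -/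
theorem exists_isParent [ProperSpace X] [NoncompactSpace X] [PerfectSpace X] {T : Set X}
    (hT : IsBall T) : ∃ T', IsParent T T' := by
  obtain ⟨x, hx⟩ := hT.nonempty
  obtain ⟨y, hy⟩ : ∃ y, y ∉ T := by
    by_contra! hall
    exact noncompact_univ X (by rw [← Set.eq_univ_of_forall hall]; exact hT.isCompact)
  have hxy : 0 < dist y x := dist_pos.2 fun h => hy (h ▸ hx)
  have hB : IsBall (Metric.closedBall x (dist y x)) := isBall_closedBall x hxy
  have hyB : y ∈ Metric.closedBall x (dist y x) := Metric.mem_closedBall.2 le_rfl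
  have hTB : T ⊂ Metric.closedBall x (dist y x) := by
    rcases hT.subset_or_subset hB hx (Metric.mem_closedBall_self hxy.le) with h | h
    · exact ⟨h, fun h' => hy (h' hyB)⟩
    · exact absurd (h hyB) hy
  let s : Set (Set X) := {B | IsBall B ∧ T ⊂ B ∧ B ⊆ Metric.closedBall x (dist y x)}
  have hs : s.Finite := (finite_balls_subset hB.isCompact hT.diam_pos).subset fun B h =>
    ⟨h.1, h.2.2, h.1.diam_mono h.2.1.1⟩
  obtain ⟨T', ⟨hT', hTT', hT'B⟩, hmin⟩ := Set.exists_min_image s Metric.diam hs ⟨_, hB, hTB, le_rfl⟩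
  refine ⟨T', hT, hT', hTT', fun S hS h1 h2 => ?_⟩
  by_cases hST : S = T
  · exact Or.inl hST
  · right
    have hTS : T ⊂ S := LE.le.ssubset_of_ne h1 (Ne.symm hST)
    exact Set.Subset.antisymm h2 (hT'.subset_of_diam_le hS (hTT'.1 hx) (h1 hx)
      (hmin S ⟨hS, hTS, h2.trans hT'B⟩))

/-- A ball is mapped to any ball of the same diameter by an isometry. -/
theorem exists_image_eq (hX : IsHomogeneous X) {B B' : Set X} (hB : IsBall B) (hB' : IsBall B')
    (h : Metric.diam B = Metric.diam B') {x y : X} (hx : x ∈ B) (hy : y ∈ B') :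
    ∃ e : X ≃ᵢ X, e x = y ∧ e '' B = B' := by
  obtain ⟨e, he⟩ := hX x y
  refine ⟨e, he, (hB.image e).eq_of_diam_eq hB' ⟨x, hx, he⟩ hy ?_⟩
  rw [e.diam_image, h]

/-- In general a ball may have diameter smaller than its radius; here the ball is the image of `A`
under an isometry, so each point has a ball of the horocycle around it. -/
theorem diam_closedBall_diam (hX : IsHomogeneous X) [PerfectSpace X] {A : Set X} (hA : IsBall A)
    (x : X) : Metric.diam (Metric.closedBall x (Metric.diam A)) = Metric.diam A := by
  obtain ⟨y, hy⟩ := hA.nonempty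
  obtain ⟨e, he⟩ := hX y x
  nth_rewrite 2 [hA.eq_closedBall hy]
  rw [← he, ← e.image_closedBall, e.diam_image]

theorem closedBall_mem_horocycle (hX : IsHomogeneous X) [PerfectSpace X] {A : Set X}
    (hA : IsBall A) (x : X) : Metric.closedBall x (Metric.diam A) ∈ horocycle A :=
  ⟨isBall_closedBall x hA.diam_pos, diam_closedBall_diam hX hA x⟩

theorem eq_of_mem_horocycle {A B B' : Set X} (hB : B ∈ horocycle A) (hB' : B' ∈ horocycle A)
    {x : X} (hx : x ∈ B) (hx' : x ∈ B') : B = B' :=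
  hB.1.eq_of_diam_eq hB'.1 hx hx' (hB.2.trans hB'.2.symm)

theorem potential_eq {A : Set X} (σ : horocycle A → ℝ) (B : horocycle A) {x : X}
    (hx : x ∈ (B : Set X)) : potential A σ x = σ B := by
  rw [potential, finsum_eq_single _ B, Set.indicator_of_mem hx]
  intro B' hB'
  refine Set.indicator_of_notMem (fun hx' => hB' ?_) _
  exact Subtype.ext (eq_of_mem_horocycle B'.2 B.2 hx' hx)

end Ultrametric

/-! ### The eigenvalues of the hierarchical Laplacian -/

/-- The eigenvalue `∑_{T ⊇ B} C(T)`. -/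
def eigenvalue (C : Set X → ℝ) (B : Set X) : ℝ := ∑' T : {T : Set X // IsBall T ∧ B ⊆ T}, C T

/-- The bijection between the balls containing `B` and `e B`. -/
def ballsAboveEquiv (e : X ≃ᵢ X) {B B' : Set X} (h : e '' B = B') :
    {T : Set X // IsBall T ∧ B ⊆ T} ≃ {T : Set X // IsBall T ∧ B' ⊆ T} where
  toFun T := ⟨e '' T, T.2.1.image e, h ▸ Set.image_mono T.2.2⟩
  invFun T := ⟨e.symm '' T, T.2.1.image e.symm, by
    have h1 := Set.image_mono (f := e.symm) T.2.2
    have h2 : e.symm '' B' = B := by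
      rw [← h, ← Set.image_comp, show (e.symm ∘ e : X → X) = id by ext; simp, Set.image_id]
    rwa [h2] at h1⟩
  left_inv T := Subtype.ext (by
    change e.symm '' (e '' T) = T
    rw [← Set.image_comp, show (e.symm ∘ e : X → X) = id by ext; simp, Set.image_id])
  right_inv T := Subtype.ext (by
    change e '' (e.symm '' T) = T
    rw [← Set.image_comp, show (e ∘ e.symm : X → X) = id by ext; simp, Set.image_id])

theorem eigenvalue_eq_of_diam_eq [IsUltrametricDist X] (hX : IsHomogeneous X) {C : Set X → ℝ}
    (hC : IsChoiceFunction C) {B B' : Set X} (hB : IsBall B) (hB' : IsBall B')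
    (h : Metric.diam B = Metric.diam B') : eigenvalue C B = eigenvalue C B' := by
  obtain ⟨x, hx⟩ := hB.nonempty
  obtain ⟨y, hy⟩ := hB'.nonempty
  obtain ⟨e, -, he⟩ := exists_image_eq hX hB hB' h hx hy
  rw [eigenvalue, eigenvalue, ← (ballsAboveEquiv e he).tsum_eq]
  refine tsum_congr fun T => ?_
  exact hC.eq_of_diam_eq _ _ T.2.1 (T.2.1.image e) (e.diam_image _).symm

/-- Passing to the smaller ball enlarges the index set of a positive series, and `B` itself is a new
term. -/
theorem eigenvalue_lt_of_ssubset {C : Set X → ℝ} (hC : IsChoiceFunction C) {B B' : Set X}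
    (hB : IsBall B) (hB' : IsBall B') (h : B ⊂ B') : eigenvalue C B' < eigenvalue C B := by
  have h1 : ∀ D : Set X, eigenvalue C D = ∑' T, {T : Set X | IsBall T ∧ D ⊆ T}.indicator C T :=
    fun D => tsum_subtype {T : Set X | IsBall T ∧ D ⊆ T} C
  have h2 : ∀ D : Set X, IsBall D → Summable ({T : Set X | IsBall T ∧ D ⊆ T}.indicator C) :=
    fun D hD => summable_subtype_iff_indicator.1 (hC.summable D hD)
  rw [h1, h1]
  have hBB : B ∈ {T : Set X | IsBall T ∧ B ⊆ T} := ⟨hB, le_rfl⟩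
  have hBB' : B ∉ {T : Set X | IsBall T ∧ B' ⊆ T} := fun hh => h.2 hh.2
  refine Summable.tsum_lt_tsum (i := B) (fun T => ?_) ?_ (h2 B' hB') (h2 B hB)
  · by_cases hT : T ∈ {T : Set X | IsBall T ∧ B' ⊆ T}
    · have hT' : T ∈ {T : Set X | IsBall T ∧ B ⊆ T} := ⟨hT.1, h.1.trans hT.2⟩
      rw [Set.indicator_of_mem hT, Set.indicator_of_mem hT']
    · rw [Set.indicator_of_notMem hT]
      exact Set.indicator_nonneg (fun S hS => (hC.pos S hS.1).le) T
  · rw [Set.indicator_of_notMem hBB', Set.indicator_of_mem hBB]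
    exact hC.pos B hB

/-- The eigenvalue is a strictly decreasing function of the diameter: homogeneity moves the larger
ball to a point of the smaller one, where the two are nested. This is the source of finite
multiplicities. -/
theorem diam_eq_of_eigenvalue_eq [IsUltrametricDist X] [PerfectSpace X] (hX : IsHomogeneous X)
    {C : Set X → ℝ} (hC : IsChoiceFunction C) {B B' : Set X} (hB : IsBall B) (hB' : IsBall B')
    (h : eigenvalue C B = eigenvalue C B') : Metric.diam B = Metric.diam B' := by
  have key : ∀ {D D' : Set X}, IsBall D → IsBall D' → Metric.diam D < Metric.diam D' →
      eigenvalue C D' < eigenvalue C D := by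
    intro D D' hD hD' hlt
    obtain ⟨x, hx⟩ := hD.nonempty
    have hm := closedBall_mem_horocycle hX hD' x
    rw [eigenvalue_eq_of_diam_eq hX hC hD' hm.1 hm.2.symm]
    have hxm : x ∈ Metric.closedBall x (Metric.diam D') :=
      Metric.mem_closedBall_self Metric.diam_nonneg
    refine eigenvalue_lt_of_ssubset hC hD hm.1 (LE.le.ssubset_of_ne
      (hD.subset_of_diam_le hm.1 hx hxm (hlt.le.trans hm.2.ge)) fun he => ?_)
    rw [he, hm.2] at hlt
    exact lt_irrefl _ hlt
  rcases lt_trichotomy (Metric.diam B) (Metric.diam B') with hlt | heq | hlt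
  · exact absurd h (key hB hB' hlt).ne'
  · exact heq
  · exact absurd h (key hB' hB hlt).ne

/-- The index set of the functions `f_T` with `T` properly contained in a ball of the horocycle. -/
def LocalPair (A : Set X) : Type _ :=
  {p : Set X × Set X // IsParent p.1 p.2 ∧ ∃ B : horocycle A, p.1 ⊂ B}

namespace LocalPair

variable {A : Set X}

/-- The ball of the horocycle which contains `T`. -/
def block (j : LocalPair A) : horocycle A := j.2.2.choose

theorem isParent (j : LocalPair A) : IsParent j.1.1 j.1.2 := j.2.1

theorem ssubset_block (j : LocalPair A) : j.1.1 ⊂ (j.block : Set X) := j.2.2.choose_spec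

variable [IsUltrametricDist X]

theorem subset_block (j : LocalPair A) : j.1.2 ⊆ (j.block : Set X) :=
  j.isParent.subset_of_ssubset j.block.2.1 j.ssubset_block

theorem block_eq (j : LocalPair A) (B : horocycle A) (h : j.1.1 ⊂ (B : Set X)) :
    j.block = B := by
  obtain ⟨x, hx⟩ := j.isParent.1.nonempty
  exact Subtype.ext (eq_of_mem_horocycle j.block.2 B.2 (j.ssubset_block.1 hx) (h.1 hx))

/-- There are finitely many `f_T` with a given eigenvalue in every block. -/
theorem finite_eigenvalue [ProperSpace X] [PerfectSpace X] (hX : IsHomogeneous X)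
    {C : Set X → ℝ} (hC : IsChoiceFunction C) (B : horocycle A) (t : ℝ) :
    {j : LocalPair A | j.block = B ∧ eigenvalue C j.1.2 = t}.Finite := by
  rcases Set.eq_empty_or_nonempty {j : LocalPair A | j.block = B ∧ eigenvalue C j.1.2 = t}
    with h | ⟨j₁, hj₁, ht₁⟩
  · rw [h]; exact Set.finite_empty
  have hfin := finite_balls_subset B.2.1.isCompact j₁.isParent.1.diam_pos
  refine Set.Finite.of_finite_image (f := Subtype.val) ((hfin.prod hfin).subset ?_)
    Subtype.val_injective.injOn
  rintro _ ⟨j, ⟨hj, ht⟩, rfl⟩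
  -- Equal eigenvalues make the parents isometric, hence also their children; so all pairs consist
  -- of subballs of `B` with diameter at least that of the child in `j₁`.
  have hd2 : Metric.diam j₁.1.2 = Metric.diam j.1.2 :=
    diam_eq_of_eigenvalue_eq hX hC j₁.isParent.2.1 j.isParent.2.1 (ht₁.trans ht.symm)
  obtain ⟨x₁, hx₁⟩ := j₁.isParent.1.nonempty
  obtain ⟨x, hx⟩ := j.isParent.1.nonempty
  obtain ⟨e, he, heq⟩ := exists_image_eq hX j₁.isParent.2.1 j.isParent.2.1 hd2
    (j₁.isParent.2.2.1.1 hx₁) (j.isParent.2.2.1.1 hx)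
  have hp := j₁.isParent.image e
  rw [heq] at hp
  have h1 : e '' j₁.1.1 = j.1.1 := hp.eq_of_mem j.isParent ⟨x₁, hx₁, he⟩ hx
  have hd1 : Metric.diam j₁.1.1 = Metric.diam j.1.1 := by rw [← h1, e.diam_image]
  refine ⟨⟨j.isParent.1, hj ▸ j.ssubset_block.1, hd1.le⟩,
    ⟨j.isParent.2.1, hj ▸ j.subset_block, hd1.le.trans ?_⟩⟩
  exact j.isParent.2.1.diam_mono j.isParent.2.2.1.1

/-- Every eigenvalue occurs in every block. -/
theorem exists_eigenvalue (hX : IsHomogeneous X) {C : Set X → ℝ} (hC : IsChoiceFunction C)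
    (B : horocycle A) (j : LocalPair A) :
    ∃ k : LocalPair A, k.block = B ∧ eigenvalue C k.1.2 = eigenvalue C j.1.2 := by
  obtain ⟨x, hx⟩ := j.isParent.1.nonempty
  obtain ⟨y, hy⟩ := B.2.1.nonempty
  obtain ⟨e, he, heq⟩ := exists_image_eq hX j.block.2.1 B.2.1 (j.block.2.2.trans B.2.2.symm)
    (j.ssubset_block.1 hx) hy
  have hss : e '' j.1.1 ⊂ (B : Set X) := by
    rw [← heq]; exact e.injective.image_strictMono j.ssubset_block
  let k : LocalPair A := ⟨(e '' j.1.1, e '' j.1.2), j.isParent.image e, B, hss⟩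
  exact ⟨k, k.block_eq B hss, eigenvalue_eq_of_diam_eq hX hC (j.isParent.2.1.image e)
    j.isParent.2.1 (e.diam_image _)⟩

theorem nonempty [ProperSpace X] [NoncompactSpace X] [PerfectSpace X] (hA : IsBall A) :
    Nonempty (LocalPair A) := by
  obtain ⟨x, hx⟩ := hA.nonempty
  have hpos := half_pos hA.diam_pos
  have hT := isBall_closedBall x hpos
  have hd : Metric.diam (Metric.closedBall x (Metric.diam A / 2)) ≤ Metric.diam A / 2 := by
    refine Metric.diam_le_of_forall_dist_le hpos.le fun y hy z hz => ?_
    rw [IsUltrametricDist.closedBall_eq_of_mem hz] at hy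
    exact hy
  have hlt : Metric.diam (Metric.closedBall x (Metric.diam A / 2)) < Metric.diam A :=
    hd.trans_lt (half_lt_self hA.diam_pos)
  obtain ⟨T', hT'⟩ := exists_isParent hT
  refine ⟨⟨(_, T'), hT', ⟨A, hA, rfl⟩, LE.le.ssubset_of_ne
    (hT.subset_of_diam_le hA (Metric.mem_closedBall_self hpos.le) hx hlt.le) fun he => ?_⟩⟩
  change Metric.closedBall x (Metric.diam A / 2) = A at he
  rw [he] at hlt
  exact lt_irrefl _ hlt

end LocalPair

/-- The potential tends to infinity at infinity if and only if its values on the horocycle do. -/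
theorem tendsto_potential_iff [IsUltrametricDist X] [ProperSpace X] [PerfectSpace X]
    (hX : IsHomogeneous X) {A : Set X} (hA : IsBall A) (σ : horocycle A → ℝ) :
    Tendsto (fun x => |potential A σ x|) (cocompact X) atTop ↔
      Tendsto (fun B => |σ B|) cofinite atTop := by
  simp only [tendsto_atTop]
  refine forall_congr' fun b => ?_
  constructor
  · intro h
    obtain ⟨K, hK, hKb⟩ := mem_cocompact.1 h
    change {B | ¬ b ≤ |σ B|}.Finite
    refine Set.Finite.of_finite_image (f := Subtype.val) ?_ Subtype.val_injective.injOn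
    refine (finite_balls_subset hK hA.diam_pos).subset ?_
    rintro _ ⟨B, hB, rfl⟩
    refine ⟨B.2.1, fun x hx => ?_, B.2.2.ge⟩
    by_contra hxK
    have := hKb hxK
    simp only [Set.mem_ofPred_eq, potential_eq σ B hx] at this
    exact hB this
  · intro h
    have h' : {B | ¬ b ≤ |σ B|}.Finite := h
    refine mem_cocompact.2 ⟨_, h'.isCompact_biUnion fun B _ => B.2.1.isCompact, fun x hx => ?_⟩
    have hm := closedBall_mem_horocycle hX hA x
    have hxm : x ∈ Metric.closedBall x (Metric.diam A) :=
      Metric.mem_closedBall_self Metric.diam_nonneg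
    have he := potential_eq σ ⟨_, hm⟩ hxm
    by_contra hcon
    refine hx (Set.mem_iUnion₂.2 ⟨⟨_, hm⟩, ?_, hxm⟩)
    rw [Set.mem_ofPred_eq, ← he]
    exact hcon

end Hierarchical

/-! ### Indicator functions of balls in `L²` -/

namespace Hierarchical

local notation "⟪" x ", " y "⟫" => inner ℂ x y

/-- The pointwise sum of a series converging in `L²`. -/
theorem ae_eq_of_hasSum_Lp {X κ : Type*} [MeasurableSpace X] {m : Measure X} [Countable κ]
    (F : κ → Lp ℂ 2 m) (a : Lp ℂ 2 m) (hF : HasSum F a) (f : κ → X → ℂ)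
    (hf : ∀ k, F k =ᵐ[m] f k) (g : X → ℂ) (hg : ∀ x, HasSum (fun k => f k x) (g x)) :
    a =ᵐ[m] g := by
  have h1 : Tendsto (fun s : Finset κ => ∑ k ∈ s, F k) atTop (𝓝 a) := hF
  obtain ⟨ns, hns, hae⟩ := (tendstoInMeasure_of_tendsto_Lp h1).exists_seq_tendsto_ae'
  -- The finite sets `ns n` are cofinal, so the almost everywhere limit along them must equal the
  -- unconditional pointwise sum.
  have h2 : ∀ᵐ x ∂m, ∀ k, F k x = f k x := ae_all_iff.2 hf
  have h3 : ∀ᵐ x ∂m, ∀ n, (∑ k ∈ ns n, F k : Lp ℂ 2 m) x = ∑ k ∈ ns n, F k x := by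
    refine ae_all_iff.2 fun n => ?_
    filter_upwards [Lp.coeFn_finsetSum (ns n) F] with x hx
    rw [hx, Finset.sum_apply]
  filter_upwards [hae, h2, h3] with x hx1 hx2 hx3
  have h4 : Tendsto (fun n => ∑ k ∈ ns n, f k x) atTop (𝓝 (a x)) := by
    simpa only [hx3, hx2] using hx1
  have h5 : Tendsto (fun n => ∑ k ∈ ns n, f k x) atTop (𝓝 (g x)) := (hg x).comp hns
  exact tendsto_nhds_unique h4 h5

variable {X : Type*} [MetricSpace X] [ProperSpace X] [MeasurableSpace X] [BorelSpace X]
  (m : Measure X) [IsFiniteMeasureOnCompacts m]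

omit [ProperSpace X] in
theorem IsBall.measurableSet {B : Set X} (hB : IsBall B) : MeasurableSet B :=
  hB.isClosed.measurableSet

omit [BorelSpace X] in
theorem IsBall.measure_ne_top {B : Set X} (hB : IsBall B) : m B ≠ ∞ :=
  hB.isCompact.measure_lt_top.ne

/-- The indicator function of a ball in `L²`. -/
def ballInd {B : Set X} (hB : IsBall B) : Lp ℂ 2 m :=
  indicatorConstLp 2 hB.measurableSet (hB.measure_ne_top m) 1

theorem ballInd_coeFn {B : Set X} (hB : IsBall B) : ballInd m hB =ᵐ[m] B.indicator fun _ => 1 :=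
  indicatorConstLp_coeFn

theorem inner_ballInd {B B' : Set X} (hB : IsBall B) (hB' : IsBall B') :
    ⟪ballInd m hB, ballInd m hB'⟫ = ((m.real (B ∩ B') : ℝ) : ℂ) :=
  L2.inner_indicatorConstLp_one_indicatorConstLp_one _ _ _ _

theorem norm_sq_ballInd {B : Set X} (hB : IsBall B) : ‖ballInd m hB‖ ^ 2 = m.real B := by
  have h := inner_ballInd m hB hB
  rw [Set.inter_self, inner_self_eq_norm_sq_to_K] at h
  refine Complex.ofReal_injective ?_
  push_cast at h ⊢
  exact h

omit [BorelSpace X] in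
theorem IsBall.measureReal_pos [m.IsOpenPosMeasure] [IsUltrametricDist X] {B : Set X}
    (hB : IsBall B) : 0 < m.real B :=
  ENNReal.toReal_pos (hB.isOpen.measure_pos m hB.nonempty).ne' (hB.measure_ne_top m)

theorem IsBall.measureReal_lt [m.IsOpenPosMeasure] [IsUltrametricDist X] {B B' : Set X}
    (hB : IsBall B) (hB' : IsBall B') (h : B ⊂ B') : m.real B < m.real B' := by
  have h1 : m.real (B' \ B) = m.real B' - m.real B :=
    measureReal_sdiff h.1 hB.measurableSet (hB'.measure_ne_top m)
  have hopen : IsOpen (B' \ B) := hB'.isOpen.sdiff hB.isClosed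
  have h2 : 0 < m.real (B' \ B) :=
    ENNReal.toReal_pos (hopen.measure_pos m (Set.nonempty_of_ssubset h)).ne'
      (measure_ne_top_of_subset Set.sdiff_subset (hB'.measure_ne_top m))
  linarith

/-- The function `f_T` in `L²`. -/
def haarVec {T T' : Set X} (h : IsParent T T') : Lp ℂ 2 m :=
  ((m.real T : ℝ) : ℂ)⁻¹ • ballInd m h.1 - ((m.real T' : ℝ) : ℂ)⁻¹ • ballInd m h.2.1

theorem haarVec_coeFn {T T' : Set X} (h : IsParent T T') : haarVec m h =ᵐ[m] haar m T T' := by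
  filter_upwards [Lp.coeFn_sub (((m.real T : ℝ) : ℂ)⁻¹ • ballInd m h.1)
    (((m.real T' : ℝ) : ℂ)⁻¹ • ballInd m h.2.1), Lp.coeFn_smul ((m.real T : ℝ) : ℂ)⁻¹ (ballInd m h.1),
    Lp.coeFn_smul ((m.real T' : ℝ) : ℂ)⁻¹ (ballInd m h.2.1), ballInd_coeFn m h.1,
    ballInd_coeFn m h.2.1] with x h1 h2 h3 h4 h5
  rw [haarVec, h1, Pi.sub_apply, h2, h3, Pi.smul_apply, Pi.smul_apply, h4, h5, haar]
  by_cases hx : x ∈ T <;> by_cases hx' : x ∈ T' <;> simp [hx, hx']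

variable [m.IsOpenPosMeasure] [IsUltrametricDist X]

omit [m.IsOpenPosMeasure] [IsUltrametricDist X] in
theorem inner_ballInd_haarVec {B T T' : Set X} (hB : IsBall B) (h : IsParent T T') :
    ⟪ballInd m hB, haarVec m h⟫ = ((m.real T : ℝ) : ℂ)⁻¹ * ((m.real (B ∩ T) : ℝ) : ℂ) -
      ((m.real T' : ℝ) : ℂ)⁻¹ * ((m.real (B ∩ T') : ℝ) : ℂ) := by
  rw [haarVec, inner_sub_right, inner_smul_right, inner_smul_right, inner_ballInd, inner_ballInd]

/-- The function `f_T` is orthogonal to the functions which are constant on `T'`. -/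
theorem inner_ballInd_haarVec_eq_zero {B T T' : Set X} (hB : IsBall B) (h : IsParent T T')
    (hBT : T' ⊆ B ∨ Disjoint B T') : ⟪ballInd m hB, haarVec m h⟫ = 0 := by
  rw [inner_ballInd_haarVec]
  have hT : ((m.real T : ℝ) : ℂ) ≠ 0 := Complex.ofReal_ne_zero.2 (h.1.measureReal_pos m).ne'
  have hT' : ((m.real T' : ℝ) : ℂ) ≠ 0 := Complex.ofReal_ne_zero.2 (h.2.1.measureReal_pos m).ne'
  rcases hBT with hs | hd
  · rw [Set.inter_eq_right.2 hs, Set.inter_eq_right.2 (h.2.2.1.1.trans hs), inv_mul_cancel₀ hT,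
      inv_mul_cancel₀ hT', sub_self]
  · rw [hd.inter_eq, (hd.mono_right h.2.2.1.1).inter_eq]
    simp

theorem inner_haarVec_ballInd_eq_zero {B T T' : Set X} (hB : IsBall B) (h : IsParent T T')
    (hBT : T' ⊆ B ∨ Disjoint B T') : ⟪haarVec m h, ballInd m hB⟫ = 0 := by
  rw [← inner_conj_symm, inner_ballInd_haarVec_eq_zero m hB h hBT, map_zero]

/-- Its inner product with the indicator of `T` is `1 - m(T) / m(T')`, which is positive because the
nonempty open set `T' \ T` has positive measure. -/
theorem haarVec_ne_zero {T T' : Set X} (h : IsParent T T') : haarVec m h ≠ 0 := by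
  intro h0
  have h1 := inner_ballInd_haarVec m h.1 h
  have hT := h.1.measureReal_pos m
  have hT' := h.2.1.measureReal_pos m
  have hlt := h.1.measureReal_lt m h.2.1 h.2.2.1
  rw [h0, inner_zero_right, Set.inter_self, Set.inter_eq_left.2 h.2.2.1.1] at h1
  have h2 : (0 : ℝ) = (m.real T)⁻¹ * m.real T - (m.real T')⁻¹ * m.real T := by exact_mod_cast h1
  rw [inv_mul_cancel₀ hT.ne'] at h2
  have h3 : (m.real T')⁻¹ * m.real T < 1 := by
    rw [inv_mul_lt_iff₀ hT', mul_one]; exact hlt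
  linarith

/-- `f_T` and `f_S` are orthogonal if `T'` and `S'` have different diameters. -/
theorem inner_haarVec_of_diam_lt {T T' S S' : Set X} (h : IsParent T T') (h' : IsParent S S')
    (hlt : Metric.diam T' < Metric.diam S') : ⟪haarVec m h, haarVec m h'⟫ = 0 := by
  have key : T' ⊆ S ∨ Disjoint S T' := by
    by_cases hd : Disjoint S T'
    · exact Or.inr hd
    · obtain ⟨x, hxS, hxT⟩ := Set.not_disjoint_iff.1 hd
      have hsub : T' ⊆ S' := h.2.1.subset_of_diam_le h'.2.1 hxT (h'.2.2.1.1 hxS) hlt.le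
      have hss : T' ⊂ S' := LE.le.ssubset_of_ne hsub fun he => by
        rw [he] at hlt; exact lt_irrefl _ hlt
      rcases h'.subset_or_disjoint h.2.1 hss with h1 | h1
      · exact Or.inl h1
      · exact absurd h1.symm hd
  have key' : T' ⊆ S' ∨ Disjoint S' T' := by
    by_cases hd : Disjoint S' T'
    · exact Or.inr hd
    · obtain ⟨x, hxS, hxT⟩ := Set.not_disjoint_iff.1 hd
      exact Or.inl (h.2.1.subset_of_diam_le h'.2.1 hxT hxS hlt.le)
  rw [haarVec.eq_def m h', inner_sub_right, inner_smul_right, inner_smul_right,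
    inner_haarVec_ballInd_eq_zero m _ _ key, inner_haarVec_ballInd_eq_zero m _ _ key']
  simp

theorem inner_haarVec_of_disjoint {T T' S S' : Set X} (h : IsParent T T') (h' : IsParent S S')
    (hd : Disjoint T' S') : ⟪haarVec m h, haarVec m h'⟫ = 0 := by
  rw [haarVec.eq_def m h', inner_sub_right, inner_smul_right, inner_smul_right,
    inner_haarVec_ballInd_eq_zero m _ _ (Or.inr hd.symm),
    inner_haarVec_ballInd_eq_zero m _ _ (Or.inr (hd.symm.mono_left h'.2.2.1.1))]
  simp

/-! ### Density of the locally constant functions with compact support -/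

/-- A locally constant function with compact support is constant on the balls of some radius. -/
theorem exists_closedBall_subset_fiber {Y : Type*} [MetricSpace Y] {f : Y → ℂ}
    (hf : IsLocallyConstant f) (hfc : HasCompactSupport f) {ρ : ℝ} (hρ : 0 < ρ) :
    ∃ δ, 0 < δ ∧ δ ≤ ρ ∧ ∀ x ∈ tsupport f, ∀ y ∈ Metric.closedBall x δ, f y = f x := by
  obtain ⟨δ, hδ, h⟩ := lebesgue_number_lemma_of_metric (c := fun c : ℂ => f ⁻¹' {c}) hfc
    (fun c => hf.isOpen_fiber c) fun x _ => Set.mem_iUnion.2 ⟨f x, rfl⟩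
  refine ⟨min (δ / 2) ρ, lt_min (half_pos hδ) hρ, min_le_right _ _, fun x hx y hy => ?_⟩
  obtain ⟨c, hc⟩ := h x hx
  have h1 : y ∈ Metric.ball x δ :=
    (Metric.mem_closedBall.1 hy).trans_lt ((min_le_left _ _).trans_lt (half_lt_self hδ))
  have h2 : f y = c := hc h1
  have h3 : f x = c := hc (Metric.mem_ball_self hδ)
  rw [h2, h3]

omit [m.IsOpenPosMeasure] in
/-- A space of functions in `L²` containing the indicators of all small balls contains the locally
constant functions with compact support. -/
theorem mem_of_isLocallyConstant (W : Submodule ℂ (Lp ℂ 2 m)) {ρ : ℝ} (hρ : 0 < ρ)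
    (hW : ∀ (x : X) (r : ℝ) (hr : 0 < r), r ≤ ρ → ballInd m (isBall_closedBall x hr) ∈ W)
    (f : X → ℂ) (hf : IsLocallyConstant f) (hfc : HasCompactSupport f) (u : Lp ℂ 2 m)
    (hu : u =ᵐ[m] f) : u ∈ W := by
  classical
  obtain ⟨δ, hδ, hδρ, hconst⟩ := exists_closedBall_subset_fiber hf hfc hρ
  obtain ⟨t, htK, ht, hcov⟩ := (show IsCompact (tsupport f) from hfc).finite_cover_balls hδ
  -- Indexing by the balls rather than by their centres removes repetitions, so the balls in `s` are
  -- pairwise disjoint.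
  let s : Set (Set X) := (fun x => Metric.closedBall x δ) '' t
  have hs : s.Finite := ht.image _
  have : Fintype s := hs.fintype
  choose c hct hc using fun B : s => B.2
  have hcB : ∀ B : s, Metric.closedBall (c B) δ = (B : Set X) := hc
  have hsum : u = ∑ B : s, f (c B) • ballInd m (isBall_closedBall (c B) hδ) := by
    refine Lp.ext ?_
    have h1 : ∀ᵐ x ∂m, ∀ B : s, (f (c B) • ballInd m (isBall_closedBall (c B) hδ) : Lp ℂ 2 m) x =
        f (c B) * (B : Set X).indicator (fun _ => 1) x := by
      refine ae_all_iff.2 fun B => ?_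
      filter_upwards [Lp.coeFn_smul (f (c B)) (ballInd m (isBall_closedBall (c B) hδ)),
        ballInd_coeFn m (isBall_closedBall (c B) hδ)] with x hx1 hx2
      rw [hx1, Pi.smul_apply, hx2, smul_eq_mul, hcB]
    filter_upwards [hu, h1, Lp.coeFn_finsetSum Finset.univ
      fun B : s => f (c B) • ballInd m (isBall_closedBall (c B) hδ)] with x hx1 hx2 hx3
    rw [hx1, hx3, Finset.sum_apply]
    simp only [hx2]
    by_cases hx : ∃ B : s, x ∈ (B : Set X)
    · obtain ⟨B, hB⟩ := hx
      rw [Finset.sum_eq_single B]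
      · rw [Set.indicator_of_mem hB, mul_one]
        rw [← hcB] at hB
        exact hconst _ (htK (hct B)) x hB
      · intro B' _ hne
        rw [Set.indicator_of_notMem, mul_zero]
        intro hB'
        refine hne (Subtype.ext ?_)
        rw [← hcB] at hB hB'
        rw [← hcB, ← hcB, IsUltrametricDist.closedBall_eq_of_mem hB,
          IsUltrametricDist.closedBall_eq_of_mem hB']
      · exact fun h => absurd (Finset.mem_univ _) h
    · push Not at hx
      rw [Finset.sum_eq_zero fun B _ => by rw [Set.indicator_of_notMem (hx B), mul_zero]]
      by_contra hne
      obtain ⟨y, hy, hxy⟩ := Set.mem_iUnion₂.1 (hcov (subset_tsupport f hne))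
      exact hx ⟨_, y, hy, rfl⟩ (Metric.ball_subset_closedBall hxy)
  rw [hsum]
  exact Submodule.sum_mem _ fun B _ => Submodule.smul_mem _ _ (hW _ _ hδ hδρ)

omit [m.IsOpenPosMeasure] in
/-- The indicators of the small balls are total in `L²`. -/
theorem eq_zero_of_orthogonal_ballInd {ρ : ℝ} (hρ : 0 < ρ) (y : Lp ℂ 2 m)
    (hy : ∀ (x : X) (r : ℝ) (hr : 0 < r), r ≤ ρ → ⟪ballInd m (isBall_closedBall x hr), y⟫ = 0) :
    y = 0 := by
  have hint : LocallyIntegrable y m := (Lp.memLp y).locallyIntegrable one_le_two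
  have hclopen : ∀ (K : Set X), IsCompact K → IsOpen K → ∫ x in K, y x ∂m = 0 := by
    intro K hK hKo
    have hu := indicatorConstLp_coeFn (p := 2) (hs := hK.measurableSet) (hμs := hK.measure_lt_top.ne)
      (c := (1 : ℂ)) (μ := m)
    have hloc : IsLocallyConstant (K.indicator fun _ => (1 : ℂ)) := by
      exact ((LocallyConstant.const X (1 : ℂ)).indicator ⟨hK.isClosed, hKo⟩).isLocallyConstant
    have hcs : HasCompactSupport (K.indicator fun _ => (1 : ℂ)) :=
      HasCompactSupport.intro hK fun x hx => Set.indicator_of_notMem hx _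
    have hmem := mem_of_isLocallyConstant m (Submodule.span ℂ {y})ᗮ hρ (fun x r hr hrρ => ?_) _ hloc
      hcs _ hu
    · rw [← L2.inner_indicatorConstLp_one hK.measurableSet hK.measure_lt_top.ne y,
        ← inner_conj_symm, (Submodule.mem_orthogonal _ _).1 hmem y
          (Submodule.mem_span_singleton_self y), map_zero]
    · rw [Submodule.mem_orthogonal_singleton_iff_inner_left]
      exact hy x r hr hrρ
  refine (Lp.eq_zero_iff_ae_eq_zero).2
    (ae_eq_zero_of_forall_setIntegral_isCompact_eq_zero' hint fun K hK => ?_)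
  -- In a proper ultrametric space the closed thickenings of a compact set are compact and open, so
  -- arbitrary compact sets are reached as decreasing limits of sets with known integral `0`.
  let U : ℕ → Set X := fun n => Metric.cthickening (1 / ((n : ℝ) + 1)) K
  have hUc : ∀ n, IsCompact (U n) := fun n => hK.cthickening
  have hUo : ∀ n, IsOpen (U n) := fun n => by
    have hpos : 0 < 1 / ((n : ℝ) + 1) := by positivity
    change IsOpen (Metric.cthickening _ K)
    rw [hK.cthickening_eq_biUnion_closedBall hpos.le]
    exact isOpen_biUnion fun x _ => IsUltrametricDist.isOpen_closedBall x hpos.ne'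
  have hanti : Antitone U := fun a b hab =>
    Metric.cthickening_mono (one_div_le_one_div_of_le (by positivity) (by gcongr)) K
  have hinter : ⋂ n, U n = K := by
    refine Set.Subset.antisymm ?_ (Set.subset_iInter fun n => Metric.self_subset_cthickening K)
    intro x hx
    rw [← hK.isClosed.closure_eq, Metric.closure_eq_iInter_cthickening]
    refine Set.mem_iInter₂.2 fun δ hδ => ?_
    obtain ⟨n, hn⟩ := exists_nat_one_div_lt hδ
    exact Metric.cthickening_mono hn.le K (Set.mem_iInter.1 hx n)
  have hlim := Antitone.tendsto_setIntegral (fun n => (hUc n).measurableSet) hanti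
    (hint.integrableOn_isCompact (hUc 0))
  rw [hinter] at hlim
  simp only [fun n => hclopen (U n) (hUc n) (hUo n)] at hlim
  exact tendsto_nhds_unique hlim tendsto_const_nhds

end Hierarchical

namespace Hierarchical

local notation "⟪" x ", " y "⟫" => inner ℂ x y

variable {X : Type*} [MetricSpace X] [ProperSpace X] [MeasurableSpace X] [BorelSpace X]
  (m : Measure X) [IsFiniteMeasureOnCompacts m] [m.IsOpenPosMeasure] [IsUltrametricDist X]

/-- A subspace containing the indicators of the balls of a horocycle and the functions `f_T`
contains the indicators of all smaller balls. -/
theorem ballInd_mem [NoncompactSpace X] [PerfectSpace X] {A : Set X} (W : Submodule ℂ (Lp ℂ 2 m))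
    (h1 : ∀ B : horocycle A, ballInd m B.2.1 ∈ W)
    (h2 : ∀ j : LocalPair A, haarVec m j.isParent ∈ W) {B : Set X} (hB : IsBall B)
    (B₀ : horocycle A) (hBB₀ : B ⊆ B₀) : ballInd m hB ∈ W := by
  by_contra hcon
  -- A counterexample of maximal diameter is contradictory, because `1_S = m(S) (f_S + 1_{S'} /
  -- m(S'))` and the parent `S'` still lies in `B₀`.
  let s : Set (Set X) := {S | B ⊆ S ∧ S ⊆ B₀ ∧ ∃ hS : IsBall S, ballInd m hS ∉ W}
  have hs : s.Finite := (finite_balls_subset B₀.2.1.isCompact hB.diam_pos).subset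
    fun S ⟨hBS, hSB₀, hS, _⟩ => ⟨hS, hSB₀, hS.diam_mono hBS⟩
  obtain ⟨S, ⟨hBS, hSB₀, hS, hSW⟩, hmax⟩ :=
    Set.exists_max_image s Metric.diam hs ⟨B, le_rfl, hBB₀, hB, hcon⟩
  have hne : S ≠ B₀ := by
    rintro rfl
    exact hSW (h1 B₀)
  have hss : S ⊂ (B₀ : Set X) := LE.le.ssubset_of_ne hSB₀ hne
  obtain ⟨S', hp⟩ := exists_isParent hS
  have hS'B₀ : S' ⊆ B₀ := hp.subset_of_ssubset B₀.2.1 hss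
  have hS'W : ballInd m hp.2.1 ∈ W := by
    by_contra hS'
    exact (hmax S' ⟨hBS.trans hp.2.2.1.1, hS'B₀, hp.2.1, hS'⟩).not_gt
      (hS.diam_lt hp.2.1 hp.2.2.1)
  have hh : haarVec m hp ∈ W := h2 ⟨(S, S'), hp, B₀, hss⟩
  have hm : ((m.real S : ℝ) : ℂ) ≠ 0 := Complex.ofReal_ne_zero.2 (hS.measureReal_pos m).ne'
  refine hSW ?_
  have he : ballInd m hS = ((m.real S : ℝ) : ℂ) •
      (haarVec m hp + ((m.real S' : ℝ) : ℂ)⁻¹ • ballInd m hp.2.1) := by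
    rw [haarVec, sub_add_cancel, smul_smul, mul_inv_cancel₀ hm, one_smul]
  rw [he]
  exact Submodule.smul_mem _ _ (Submodule.add_mem _ hh (Submodule.smul_mem _ _ hS'W))

/-! ### Averaging operators -/

/-- The closed subspace of functions which are constant on the balls with the diameter of `T`. -/
def horoSpace (T : Set X) : Submodule ℂ (Lp ℂ 2 m) :=
  (Submodule.span ℂ {u | ∃ B : horocycle T, u = ballInd m B.2.1}).topologicalClosure

instance (T : Set X) : CompleteSpace (horoSpace m T) :=
  Submodule.topologicalClosure.completeSpace _

/-- The averaging operator over the balls with the diameter of `T`. -/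
def avg (T : Set X) : Lp ℂ 2 m →L[ℂ] Lp ℂ 2 m := (horoSpace m T).starProjection

/-- The other balls of the horocycle of `T` are disjoint from `Q`, so orthogonality of the
difference needs checking only against the indicator of `Q`, which fixes the coefficient. -/
theorem avg_ballInd {B T : Set X} (hB : IsBall B) (Q : horocycle T) (hBQ : B ⊆ Q) :
    avg m T (ballInd m hB) =
      (((m.real B / m.real (Q : Set X) : ℝ)) : ℂ) • ballInd m Q.2.1 := by
  have hQ0 := Q.2.1.measureReal_pos m
  refine Submodule.eq_starProjection_of_mem_orthogonal (Submodule.smul_mem _ _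
    (Submodule.le_topologicalClosure _ (Submodule.subset_span ⟨Q, rfl⟩))) ?_
  set w := ballInd m hB - (((m.real B / m.real (Q : Set X) : ℝ)) : ℂ) • ballInd m Q.2.1
  have hle : horoSpace m T ≤ (Submodule.span ℂ {w})ᗮ := by
    refine Submodule.topologicalClosure_minimal _ (Submodule.span_le.2 ?_)
      (Submodule.isClosed_orthogonal _)
    rintro _ ⟨Q', rfl⟩
    rw [SetLike.mem_coe, Submodule.mem_orthogonal_singleton_iff_inner_right]
    rw [inner_sub_left, inner_smul_left, Complex.conj_ofReal, inner_ballInd, inner_ballInd]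
    by_cases hQ : Q = Q'
    · subst hQ
      rw [Set.inter_eq_left.2 hBQ, Set.inter_self, ← Complex.ofReal_mul, ← Complex.ofReal_sub,
        div_mul_cancel₀ _ hQ0.ne', sub_self, Complex.ofReal_zero]
    · have hd : Disjoint (Q : Set X) Q' := by
        by_contra hcon
        obtain ⟨x, hx, hx'⟩ := Set.not_disjoint_iff.1 hcon
        exact hQ (Subtype.ext (eq_of_mem_horocycle Q.2 Q'.2 hx hx'))
      rw [hd.inter_eq, (hd.mono_left hBQ).inter_eq]
      simp
  rw [Submodule.mem_orthogonal]
  intro u hu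
  rw [← inner_conj_symm, (Submodule.mem_orthogonal_singleton_iff_inner_right).1 (hle hu), map_zero]

/-- The part of the hierarchical Laplacian which comes from the balls containing a ball of the
horocycle of `A`. -/
def longRange (C : Set X → ℝ) (A : Set X) : Lp ℂ 2 m →L[ℂ] Lp ℂ 2 m :=
  ∑' T : {T : Set X // IsBall T ∧ A ⊆ T}, (C T : ℂ) • (1 - avg m (T : Set X))

variable {C : Set X → ℝ} (hC : IsChoiceFunction C) {A : Set X} (hA : IsBall A)

include hC hA

-- Since `‖1 - avg‖ ≤ 2`, the operator series converges in norm by summability of `C`; in particular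
-- `longRange` is not the default value of `∑'`.
omit [m.IsOpenPosMeasure] [IsUltrametricDist X] in
theorem hasSum_longRange (y : Lp ℂ 2 m) :
    HasSum (fun T : {T : Set X // IsBall T ∧ A ⊆ T} => (C T : ℂ) • (y - avg m (T : Set X) y))
      (longRange m C A y) := by
  have hsum : Summable fun T : {T : Set X // IsBall T ∧ A ⊆ T} =>
      (C T : ℂ) • ((1 : Lp ℂ 2 m →L[ℂ] Lp ℂ 2 m) - avg m (T : Set X)) := by
    refine Summable.of_norm_bounded ((hC.summable A hA).mul_right 2) fun T => ?_
    rw [norm_smul, Complex.norm_real, Real.norm_of_nonneg (hC.pos _ T.2.1).le]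
    have h1 : ‖(1 : Lp ℂ 2 m →L[ℂ] Lp ℂ 2 m)‖ ≤ 1 := ContinuousLinearMap.norm_id_le
    have h2 : ‖avg m (T : Set X)‖ ≤ 1 := Submodule.starProjection_norm_le _
    have h3 := norm_sub_le (1 : Lp ℂ 2 m →L[ℂ] Lp ℂ 2 m) (avg m (T : Set X))
    have := (hC.pos _ T.2.1).le
    gcongr
    linarith
  exact hsum.hasSum.mapL (ContinuousLinearMap.apply ℂ (Lp ℂ 2 m) y)

omit [m.IsOpenPosMeasure] [IsUltrametricDist X] in
theorem inner_longRange_left (x y : Lp ℂ 2 m) :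
    ⟪longRange m C A x, y⟫ = ⟪x, longRange m C A y⟫ := by
  have h1 := (hasSum_longRange m hC hA y).mapL (innerSL ℂ x)
  have h2 := ((hasSum_longRange m hC hA x).mapL (innerSL ℂ y)).mapL
    (Complex.conjCLE : ℂ →L[ℝ] ℂ)
  simp only [innerSL_apply_apply, ContinuousLinearEquiv.coe_coe, Complex.conjCLE_apply,
    inner_conj_symm] at h1 h2
  refine h2.unique (hasSum_of_eq (fun T => ?_) h1)
  rw [inner_smul_left, inner_smul_right, Complex.conj_ofReal, inner_sub_left, inner_sub_right]
  congr 2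
  exact Submodule.inner_starProjection_left_eq_right _ _ _

/-- The long range part of the Laplacian of the indicator of a ball of the horocycle. -/
theorem hasSum_longRange_ballInd (hX : IsHomogeneous X) (B : horocycle A) :
    HasSum (fun T : {T : Set X // IsBall T ∧ (B : Set X) ⊆ T} => (C T : ℂ) •
      (ballInd m B.2.1 -
        ((m.real (B : Set X) / m.real (T : Set X) : ℝ) : ℂ) • ballInd m T.2.1))
      (longRange m C A (ballInd m B.2.1)) := by
  obtain ⟨x, hx⟩ := hA.nonempty
  obtain ⟨y, hy⟩ := B.2.1.nonempty
  obtain ⟨e, -, he⟩ := exists_image_eq hX hA B.2.1 B.2.2.symm hx hy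
  -- `longRange` sums over the balls above `A`. They may be replaced by those above `B` because `C`
  -- and the averaging operators depend only on diameters.
  rw [← (ballsAboveEquiv e he).hasSum_iff]
  have h := hasSum_longRange m hC hA (ballInd m B.2.1)
  refine Eq.mpr (congrArg (fun f => HasSum f _) (funext fun T => ?_)) h
  have hTe : IsBall (e '' (T : Set X)) := T.2.1.image e
  have hBe : (B : Set X) ⊆ e '' (T : Set X) := he ▸ Set.image_mono T.2.2
  rw [avg_ballInd m B.2.1 ⟨e '' (T : Set X), hTe, e.diam_image _⟩ hBe,
    hC.eq_of_diam_eq _ _ T.2.1 hTe (e.diam_image _).symm]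
  rfl

/-- The functions `f_T` are orthogonal to the long range part. -/
theorem inner_haarVec_longRange (hX : IsHomogeneous X) (B : horocycle A) (j : LocalPair A) :
    ⟪haarVec m j.isParent, longRange m C A (ballInd m B.2.1)⟫ = 0 := by
  have h := (hasSum_longRange_ballInd m hC hA hX B).mapL (innerSL ℂ (haarVec m j.isParent))
  refine h.unique (hasSum_of_eq (fun T => ?_) hasSum_zero)
  have key : ∀ {S : Set X} (hS : IsBall S), Metric.diam A ≤ Metric.diam S →
      ⟪haarVec m j.isParent, ballInd m hS⟫ = 0 := by
    intro S hS hd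
    refine inner_haarVec_ballInd_eq_zero m hS _ ?_
    by_cases hdis : Disjoint S j.1.2
    · exact Or.inr hdis
    · obtain ⟨x, hxS, hxj⟩ := Set.not_disjoint_iff.1 hdis
      refine Or.inl (j.isParent.2.1.subset_of_diam_le hS hxj hxS ?_)
      exact ((j.block.2.1.diam_mono j.subset_block).trans j.block.2.2.le).trans hd
  rw [innerSL_apply_apply, inner_smul_right, inner_sub_right, inner_smul_right,
    key B.2.1 B.2.2.ge, key T.2.1 (B.2.2.ge.trans (T.2.1.diam_mono T.2.2))]
  simp

omit hC hA

/-! ### The pointwise Laplacian -/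

theorem setIntegral_indicator_one {Y : Type*} [MeasurableSpace Y] (m : Measure Y) {B T : Set Y} (hB : MeasurableSet B) :
    ∫ y in T, B.indicator (fun _ => (1 : ℂ)) y ∂m = ((m.real (T ∩ B) : ℝ) : ℂ) := by
  rw [setIntegral_indicator hB, setIntegral_const]
  simp

/-- The pointwise Laplacian of the indicator of a ball. -/
def ballLaplacian (C : Set X → ℝ) (B : Set X) (x : X) : ℂ :=
  ∑' T : {T : Set X // IsBall T ∧ B ⊆ T}, (C T : ℂ) * (B.indicator (fun _ => 1) x -
    ((m.real B / m.real (T : Set X) : ℝ) : ℂ) * (T : Set X).indicator (fun _ => 1) x)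

include hC

omit [BorelSpace X] in
theorem hasSum_ballLaplacian {B : Set X} (hB : IsBall B) (x : X) :
    HasSum (fun T : {T : Set X // IsBall T ∧ B ⊆ T} => (C T : ℂ) * (B.indicator (fun _ => 1) x -
      ((m.real B / m.real (T : Set X) : ℝ) : ℂ) * (T : Set X).indicator (fun _ => 1) x))
      (ballLaplacian m C B x) := by
  refine Summable.hasSum (Summable.of_norm_bounded ((hC.summable B hB).mul_right 2) fun T => ?_)
  have h1 : ∀ S : Set X, ‖S.indicator (fun _ => (1 : ℂ)) x‖ ≤ 1 := fun S => by
    by_cases hx : x ∈ S <;> simp [hx]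
  have hTpos := T.2.1.measureReal_pos m
  have h2 : ‖((m.real B / m.real (T : Set X) : ℝ) : ℂ)‖ ≤ 1 := by
    rw [Complex.norm_real, Real.norm_of_nonneg (by positivity), div_le_one hTpos]
    exact measureReal_mono T.2.2 (T.2.1.measure_ne_top m)
  rw [norm_mul, Complex.norm_real, Real.norm_of_nonneg (hC.pos _ T.2.1).le]
  have := (hC.pos _ T.2.1).le
  gcongr
  calc _ ≤ ‖B.indicator (fun _ => (1 : ℂ)) x‖ + ‖((m.real B / m.real (T : Set X) : ℝ) : ℂ) *
        (T : Set X).indicator (fun _ => 1) x‖ := norm_sub_le _ _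
    _ ≤ 1 + 1 * 1 := by
        rw [norm_mul]
        gcongr
        · exact h1 B
        · exact h1 T
    _ = 2 := by norm_num

/-- The two series agree termwise after extension by zero. A ball through `x` not containing `B`
lies in `B` or misses it, so the indicator is constant there and the term vanishes; a ball above `B`
missing `x` contributes zero as well. -/
theorem isLaplacianOf_indicator {B : Set X} (hB : IsBall B) :
    IsLaplacianOf C m (B.indicator fun _ => 1) (ballLaplacian m C B) := by
  intro x
  have h := hasSum_ballLaplacian m hC hB x
  let F : Set X → ℂ := fun T => (C T : ℂ) * (B.indicator (fun _ => (1 : ℂ)) x -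
    ((m.real T : ℝ) : ℂ)⁻¹ * ∫ y in T, B.indicator (fun _ => (1 : ℂ)) y ∂m)
  let G : Set X → ℂ := fun T => (C T : ℂ) * (B.indicator (fun _ => 1) x -
    ((m.real B / m.real T : ℝ) : ℂ) * T.indicator (fun _ => 1) x)
  have hG : HasSum ({T : Set X | IsBall T ∧ B ⊆ T}.indicator G) (ballLaplacian m C B x) :=
    hasSum_subtype_iff_indicator.1 h
  refine (hasSum_subtype_iff_indicator (f := F) (s := {T : Set X | IsBall T ∧ x ∈ T})).2 ?_
  refine hasSum_of_eq (fun T => ?_) hG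
  have hFT : F T = (C T : ℂ) * (B.indicator (fun _ => (1 : ℂ)) x -
      ((m.real T : ℝ) : ℂ)⁻¹ * ((m.real (T ∩ B) : ℝ) : ℂ)) := by
    rw [← setIntegral_indicator_one m hB.measurableSet]
  by_cases hT : IsBall T
  swap
  · rw [Set.indicator_of_notMem fun hh => hT hh.1, Set.indicator_of_notMem fun hh => hT hh.1]
  have hT0 : ((m.real T : ℝ) : ℂ) ≠ 0 := Complex.ofReal_ne_zero.2 (hT.measureReal_pos m).ne'
  by_cases hBT : B ⊆ T
  · have hmem : T ∈ {T : Set X | IsBall T ∧ B ⊆ T} := ⟨hT, hBT⟩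
    rw [Set.indicator_of_mem hmem]
    by_cases hx : x ∈ T
    · have hmem' : T ∈ {T : Set X | IsBall T ∧ x ∈ T} := ⟨hT, hx⟩
      rw [Set.indicator_of_mem hmem', hFT, Set.inter_eq_right.2 hBT]
      simp only [G, Set.indicator_of_mem hx]
      push_cast
      ring
    · rw [Set.indicator_of_notMem fun hh => hx hh.2]
      simp only [G, Set.indicator_of_notMem hx, Set.indicator_of_notMem fun hh => hx (hBT hh)]
      simp
  · rw [Set.indicator_of_notMem (s := {T : Set X | IsBall T ∧ B ⊆ T}) fun hh => hBT hh.2]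
    by_cases hx : x ∈ T
    · have hmem' : T ∈ {T : Set X | IsBall T ∧ x ∈ T} := ⟨hT, hx⟩
      rw [Set.indicator_of_mem hmem', hFT]
      by_cases hxB : x ∈ B
      · have hTB : T ⊆ B := (hT.subset_or_subset hB hx hxB).resolve_right hBT
        rw [Set.inter_eq_left.2 hTB, Set.indicator_of_mem hxB, inv_mul_cancel₀ hT0]
        simp
      · have hd : Disjoint T B := by
          by_contra hcon
          obtain ⟨y, hyT, hyB⟩ := Set.not_disjoint_iff.1 hcon
          exact hxB ((hT.subset_or_subset hB hyT hyB).resolve_right hBT hx)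
        rw [hd.inter_eq, Set.indicator_of_notMem hxB]
        simp
    · rw [Set.indicator_of_notMem fun hh => hx hh.2]

include hA in
/-- The long range operator computes the pointwise Laplacian. -/
theorem longRange_ballInd_coeFn (hX : IsHomogeneous X) (B : horocycle A) :
    longRange m C A (ballInd m B.2.1) =ᵐ[m] ballLaplacian m C B := by
  -- A summable family of nonzero numbers has a countable index set; countability is needed to
  -- combine null sets.
  have hcount : Countable {T : Set X // IsBall T ∧ (B : Set X) ⊆ T} := by
    have h := (hC.summable B B.2.1).countable_support
    rw [Function.support_eq_univ fun T : {T : Set X // IsBall T ∧ (B : Set X) ⊆ T} =>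
      (hC.pos _ T.2.1).ne'] at h
    exact Set.countable_univ_iff.1 h
  refine ae_eq_of_hasSum_Lp _ _ (hasSum_longRange_ballInd m hC hA hX B) _ (fun T => ?_) _
    (hasSum_ballLaplacian m hC B.2.1)
  set a : ℂ := ((m.real (B : Set X) / m.real (T : Set X) : ℝ) : ℂ)
  filter_upwards [Lp.coeFn_smul (C T : ℂ) (ballInd m B.2.1 - a • ballInd m T.2.1),
    Lp.coeFn_sub (ballInd m B.2.1) (a • ballInd m T.2.1), Lp.coeFn_smul a (ballInd m T.2.1),
    ballInd_coeFn m B.2.1, ballInd_coeFn m T.2.1] with x h1 h2 h3 h4 h5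
  rw [h1, Pi.smul_apply, h2, Pi.sub_apply, h3, Pi.smul_apply, h4, h5, smul_eq_mul, smul_eq_mul]

omit hC [IsUltrametricDist X] [m.IsOpenPosMeasure] in
theorem setIntegral_haar {T T' : Set X} (h : IsParent T T') (B : Set X) :
    ∫ y in B, haar m T T' y ∂m = ((m.real T : ℝ) : ℂ)⁻¹ * ((m.real (B ∩ T) : ℝ) : ℂ) -
      ((m.real T' : ℝ) : ℂ)⁻¹ * ((m.real (B ∩ T') : ℝ) : ℂ) := by
  have hint : ∀ (S : Set X) (c : ℂ), IsBall S → IntegrableOn (S.indicator fun _ => c) B m :=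
    fun S c hS => (integrable_indicator_iff hS.measurableSet).2
      (integrableOn_const (ne_top_of_le_ne_top (hS.measure_ne_top m)
        (Measure.restrict_apply_le _ _)))
  have hset : ∀ (S : Set X) (c : ℂ), IsBall S →
      ∫ y in B, S.indicator (fun _ => c) y ∂m = c * ((m.real (B ∩ S) : ℝ) : ℂ) :=
    fun S c hS => by
      rw [setIntegral_indicator hS.measurableSet, setIntegral_const]
      simp [mul_comm]
  rw [show haar m T T' = fun y => T.indicator (fun _ => ((m.real T : ℝ) : ℂ)⁻¹) y -
    T'.indicator (fun _ => ((m.real T' : ℝ) : ℂ)⁻¹) y from rfl,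
    integral_sub (hint _ _ h.1) (hint _ _ h.2.1), hset _ _ h.1, hset _ _ h.2.1]

/-- The functions `f_T` are eigenfunctions of the pointwise Laplacian. -/
theorem isLaplacianOf_haar {T T' : Set X} (h : IsParent T T') :
    IsLaplacianOf C m (haar m T T') fun x => (eigenvalue C T' : ℂ) * haar m T T' x := by
  intro x
  have hT0 : ((m.real T : ℝ) : ℂ) ≠ 0 := Complex.ofReal_ne_zero.2 (h.1.measureReal_pos m).ne'
  have hT'0 : ((m.real T' : ℝ) : ℂ) ≠ 0 := Complex.ofReal_ne_zero.2 (h.2.1.measureReal_pos m).ne'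
  -- Termwise comparison again: over balls containing `T'` or disjoint from it the mean of `f_T` is
  -- zero, and on balls strictly inside `T'` the function is constant, so only the balls above `T'`
  -- survive.
  let F : Set X → ℂ := fun B => (C B : ℂ) * (haar m T T' x -
    ((m.real B : ℝ) : ℂ)⁻¹ * ∫ y in B, haar m T T' y ∂m)
  let G : Set X → ℂ := fun B => (C B : ℂ) * haar m T T' x
  have hG : HasSum ({B : Set X | IsBall B ∧ T' ⊆ B}.indicator G)
      ((eigenvalue C T' : ℂ) * haar m T T' x) := by
    refine hasSum_subtype_iff_indicator.1 ?_
    exact (Complex.hasSum_ofReal.2 (hC.summable T' h.2.1).hasSum).mul_right _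
  refine (hasSum_subtype_iff_indicator (f := F) (s := {B : Set X | IsBall B ∧ x ∈ B})).2 ?_
  refine hasSum_of_eq (fun B => ?_) hG
  by_cases hB : IsBall B
  swap
  · rw [Set.indicator_of_notMem fun hh => hB hh.1, Set.indicator_of_notMem fun hh => hB hh.1]
  have hB0 : ((m.real B : ℝ) : ℂ) ≠ 0 := Complex.ofReal_ne_zero.2 (hB.measureReal_pos m).ne'
  have hzero : T' ⊆ B ∨ Disjoint B T' → ∫ y in B, haar m T T' y ∂m = 0 := by
    intro hh
    rw [setIntegral_haar m h B, ← inner_ballInd_haarVec m hB h]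
    exact inner_ballInd_haarVec_eq_zero m hB h hh
  by_cases hxT' : x ∈ T'
  · by_cases hT'B : T' ⊆ B
    · have hm1 : B ∈ {B : Set X | IsBall B ∧ x ∈ B} := ⟨hB, hT'B hxT'⟩
      have hm2 : B ∈ {B : Set X | IsBall B ∧ T' ⊆ B} := ⟨hB, hT'B⟩
      rw [Set.indicator_of_mem hm1, Set.indicator_of_mem hm2]
      simp only [F, G, hzero (Or.inl hT'B), mul_zero, sub_zero]
    · rw [Set.indicator_of_notMem (s := {B : Set X | IsBall B ∧ T' ⊆ B}) fun hh => hT'B hh.2]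
      by_cases hxB : x ∈ B
      · have hm1 : B ∈ {B : Set X | IsBall B ∧ x ∈ B} := ⟨hB, hxB⟩
        rw [Set.indicator_of_mem hm1]
        have hBT' : B ⊆ T' := (hB.subset_or_subset h.2.1 hxB hxT').resolve_right hT'B
        have hval : haar m T T' x - ((m.real B : ℝ) : ℂ)⁻¹ * ∫ y in B, haar m T T' y ∂m = 0 := by
          rw [setIntegral_haar m h B, haar, Set.indicator_of_mem hxT', Set.inter_eq_left.2 hBT']
          rcases h.subset_or_disjoint hB ⟨hBT', hT'B⟩ with hs | hd
          · rw [Set.inter_eq_left.2 hs, Set.indicator_of_mem (hs hxB)]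
            field_simp
            ring
          · rw [hd.inter_eq, Set.indicator_of_notMem (Set.disjoint_left.1 hd hxB)]
            field_simp
            simp
        simp only [F, hval, mul_zero]
      · rw [Set.indicator_of_notMem fun hh => hxB hh.2]
  · have hx0 : haar m T T' x = 0 := by
      rw [haar, Set.indicator_of_notMem hxT', Set.indicator_of_notMem fun hh => hxT' (h.2.2.1.1 hh),
        sub_zero]
    have hG0 : {B : Set X | IsBall B ∧ T' ⊆ B}.indicator G B = 0 := by
      simp [G, hx0]
    rw [hG0]
    by_cases hxB : x ∈ B
    · have hm1 : B ∈ {B : Set X | IsBall B ∧ x ∈ B} := ⟨hB, hxB⟩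
      rw [Set.indicator_of_mem hm1]
      have hcase : T' ⊆ B ∨ Disjoint B T' := by
        by_cases hd : Disjoint B T'
        · exact Or.inr hd
        · obtain ⟨y, hyB, hyT⟩ := Set.not_disjoint_iff.1 hd
          exact Or.inl ((hB.subset_or_subset h.2.1 hyB hyT).resolve_left fun hs => hxT' (hs hxB))
      simp only [F, hx0, hzero hcase, mul_zero, sub_zero]
    · rw [Set.indicator_of_notMem fun hh => hxB hh.2]

end Hierarchical

/-! ### The Schrödinger operator as a block model -/

namespace Hierarchical

local notation "⟪" x ", " y "⟫" => inner ℂ x y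

variable {X : Type*} [MetricSpace X] [ProperSpace X] [MeasurableSpace X] [BorelSpace X]
  (m : Measure X) [IsFiniteMeasureOnCompacts m] [m.IsOpenPosMeasure] [IsUltrametricDist X]
  [NoncompactSpace X] [PerfectSpace X]

variable {C : Set X → ℝ} {A : Set X}

omit [BorelSpace X] [m.IsOpenPosMeasure] [NoncompactSpace X] [PerfectSpace X] [ProperSpace X]
  [MeasurableSpace X] in
theorem isLocallyConstant_indicator {B : Set X} (hB : IsBall B) (c : ℂ) :
    IsLocallyConstant (B.indicator fun _ => c) :=
  ((LocallyConstant.const X c).indicator ⟨hB.isClosed, hB.isOpen⟩).isLocallyConstant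

omit [BorelSpace X] [m.IsOpenPosMeasure] [NoncompactSpace X] [PerfectSpace X]
  [MeasurableSpace X] [IsUltrametricDist X] in
theorem hasCompactSupport_indicator {B : Set X} (hB : IsBall B) (c : ℂ) :
    HasCompactSupport (B.indicator fun _ => c) :=
  HasCompactSupport.intro hB.isCompact fun _ hx => Set.indicator_of_notMem hx _

/-- The block structure of the operator `L + V`. -/
def model (hX : IsHomogeneous X) (hC : IsChoiceFunction C) (hA : IsBall A)
    (σ : horocycle A → ℝ) : BlockModel (Lp ℂ 2 m) (horocycle A) (LocalPair A) where
  e B := (((‖ballInd m B.2.1‖)⁻¹ : ℝ) : ℂ) • ballInd m B.2.1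
  v j := haarVec m j.isParent
  σ := σ
  lam j := eigenvalue C j.1.2
  blk j := j.block
  L₀ := longRange m C A
  orthonormal := by
    refine ⟨fun B => ?_, fun B B' hne => ?_⟩
    · have h := norm_sq_ballInd m B.2.1
      have hpos := B.2.1.measureReal_pos m
      rw [← h] at hpos
      have hne : ‖ballInd m B.2.1‖ ≠ 0 := fun h0 => by
        rw [h0] at hpos
        norm_num at hpos
      rw [norm_smul, Complex.norm_real, norm_inv, norm_norm, inv_mul_cancel₀ hne]
    · have hd : Disjoint (B : Set X) B' := by
        by_contra hcon
        obtain ⟨x, hx, hx'⟩ := Set.not_disjoint_iff.1 hcon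
        exact hne (Subtype.ext (eq_of_mem_horocycle B.2 B'.2 hx hx'))
      change ⟪(((‖ballInd m B.2.1‖)⁻¹ : ℝ) : ℂ) • ballInd m B.2.1,
        (((‖ballInd m B'.2.1‖)⁻¹ : ℝ) : ℂ) • ballInd m B'.2.1⟫ = 0
      rw [inner_smul_left, inner_smul_right, inner_ballInd, hd.inter_eq]
      simp
  v_ne_zero j := haarVec_ne_zero m j.isParent
  inner_v_e B j := by
    rw [inner_smul_right, inner_haarVec_ballInd_eq_zero, mul_zero]
    by_cases hd : Disjoint (B : Set X) j.1.2
    · exact Or.inr hd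
    · obtain ⟨x, hxB, hxj⟩ := Set.not_disjoint_iff.1 hd
      exact Or.inl (eq_of_mem_horocycle B.2 j.block.2 hxB (j.subset_block hxj) ▸ j.subset_block)
  inner_v_v_of_blk j k hne := by
    refine inner_haarVec_of_disjoint m _ _ ?_
    by_contra hcon
    obtain ⟨x, hx, hx'⟩ := Set.not_disjoint_iff.1 hcon
    exact hne (Subtype.ext (eq_of_mem_horocycle j.block.2 k.block.2 (j.subset_block hx)
      (k.subset_block hx')))
  inner_v_v_of_lam j k hne := by
    rcases lt_trichotomy (Metric.diam j.1.2) (Metric.diam k.1.2) with h | h | h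
    · exact inner_haarVec_of_diam_lt m _ _ h
    · exact absurd (eigenvalue_eq_of_diam_eq hX hC j.isParent.2.1 k.isParent.2.1 h) hne
    · rw [← inner_conj_symm, inner_haarVec_of_diam_lt m _ _ h, map_zero]
  symm := inner_longRange_left m hC hA
  inner_v_L₀_e B j := by
    rw [map_smul, inner_smul_right, inner_haarVec_longRange m hC hA hX, mul_zero]
  total y hy hy' := by
    refine eq_zero_of_orthogonal_ballInd m hA.diam_pos y fun x r hr hrA => ?_
    rw [← Submodule.mem_orthogonal_singleton_iff_inner_left]
    refine ballInd_mem m (Submodule.span ℂ {y})ᗮ (fun B => ?_) (fun j => ?_) _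
      ⟨_, closedBall_mem_horocycle hX hA x⟩ (Metric.closedBall_subset_closedBall hrA)
    · rw [Submodule.mem_orthogonal_singleton_iff_inner_left]
      have h := hy B
      rw [inner_smul_left] at h
      refine (mul_eq_zero.1 h).resolve_left fun h0 => ?_
      have hpos := B.2.1.measureReal_pos m
      rw [← norm_sq_ballInd m B.2.1] at hpos
      rw [Complex.conj_ofReal, Complex.ofReal_eq_zero, inv_eq_zero] at h0
      rw [h0] at hpos
      norm_num at hpos
    · rw [Submodule.mem_orthogonal_singleton_iff_inner_left]
      exact hy' j
  finite B t := LocalPair.finite_eigenvalue hX hC B t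
  surj B j := LocalPair.exists_eigenvalue hX hC B j

variable (hX : IsHomogeneous X) (hC : IsChoiceFunction C) (hA : IsBall A) (σ : horocycle A → ℝ)

omit [NoncompactSpace X] [PerfectSpace X] in
theorem ballInd_mem_minimalGraph (hX : IsHomogeneous X) (hC : IsChoiceFunction C) (hA : IsBall A)
    (B : horocycle A) : (ballInd m B.2.1, longRange m C A (ballInd m B.2.1) +
      (σ B : ℂ) • ballInd m B.2.1) ∈ minimalGraph C m (potential A σ) := by
  refine ⟨(B : Set X).indicator fun _ => 1, ballLaplacian m C B,
    isLocallyConstant_indicator B.2.1 1, hasCompactSupport_indicator B.2.1 1,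
    isLaplacianOf_indicator m hC B.2.1, ballInd_coeFn m B.2.1, ?_⟩
  filter_upwards [Lp.coeFn_add (longRange m C A (ballInd m B.2.1)) ((σ B : ℂ) • ballInd m B.2.1),
    Lp.coeFn_smul (σ B : ℂ) (ballInd m B.2.1), ballInd_coeFn m B.2.1,
    longRange_ballInd_coeFn m hC hA hX B] with x h1 h2 h3 h4
  rw [h1, Pi.add_apply, h2, Pi.smul_apply, h3, h4, smul_eq_mul]
  by_cases hx : x ∈ (B : Set X)
  · rw [potential_eq σ B hx]
  · rw [Set.indicator_of_notMem hx, mul_zero, mul_zero]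

omit [NoncompactSpace X] [PerfectSpace X] in
theorem haarVec_mem_minimalGraph (hC : IsChoiceFunction C) (j : LocalPair A) :
    (haarVec m j.isParent, ((eigenvalue C j.1.2 + σ j.block : ℝ) : ℂ) • haarVec m j.isParent) ∈
      minimalGraph C m (potential A σ) := by
  have hp := j.isParent
  refine ⟨haar m j.1.1 j.1.2, fun x => (eigenvalue C j.1.2 : ℂ) * haar m j.1.1 j.1.2 x,
    (isLocallyConstant_indicator hp.1 _).sub (isLocallyConstant_indicator hp.2.1 _),
    (hasCompactSupport_indicator hp.1 _).sub (hasCompactSupport_indicator hp.2.1 _),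
    isLaplacianOf_haar m hC hp, haarVec_coeFn m hp, ?_⟩
  filter_upwards [Lp.coeFn_smul ((eigenvalue C j.1.2 + σ j.block : ℝ) : ℂ) (haarVec m hp),
    haarVec_coeFn m hp] with x h1 h2
  rw [h1, Pi.smul_apply, h2, smul_eq_mul]
  by_cases hx : x ∈ (j.block : Set X)
  · rw [potential_eq σ j.block hx]
    push_cast
    ring
  · have h0 : haar m j.1.1 j.1.2 x = 0 := by
      rw [haar, Set.indicator_of_notMem fun h => hx (j.ssubset_block.1 h),
        Set.indicator_of_notMem fun h => hx (j.subset_block h), sub_zero]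
    rw [h0]
    simp

/-- The graph of the minimal operator is the graph of the block model. -/
theorem model_graph : (model m hX hC hA σ).graph = minimalGraph C m (potential A σ) := by
  have hle : (model m hX hC hA σ).graph ≤ minimalGraph C m (potential A σ) := by
    rw [BlockModel.graph_eq_span]
    refine Submodule.span_le.2 ?_
    rintro _ (⟨B, rfl⟩ | ⟨j, rfl⟩)
    · have h := Submodule.smul_mem _ (((‖ballInd m B.2.1‖)⁻¹ : ℝ) : ℂ)
        (ballInd_mem_minimalGraph m σ hX hC hA B)
      have he : (((‖ballInd m B.2.1‖)⁻¹ : ℝ) : ℂ) • (ballInd m B.2.1,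
          longRange m C A (ballInd m B.2.1) + (σ B : ℂ) • ballInd m B.2.1) =
          ((model m hX hC hA σ).e B, (model m hX hC hA σ).L₀ ((model m hX hC hA σ).e B) +
            (((model m hX hC hA σ).σ B : ℝ) : ℂ) • (model m hX hC hA σ).e B) := by
        simp only [model, Prod.smul_mk, smul_add, map_smul]
        rw [smul_comm]
      rw [he] at h
      exact h
    · exact haarVec_mem_minimalGraph m σ hC j
  refine le_antisymm hle fun p hp => ?_
  -- It is enough to compare domains: `p` and `q` lie in the same graph and share their first
  -- coordinate, hence coincide.
  obtain ⟨q, hq, hqp⟩ : p.1 ∈ (model m hX hC hA σ).graph.map (LinearMap.fst ℂ _ _) := by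
    obtain ⟨f, g, hf, hfc, -, h1, -⟩ := hp
    refine mem_of_isLocallyConstant m _ hA.diam_pos (fun x r hr hrA => ?_) f hf hfc p.1 h1
    refine ballInd_mem m _ (fun B => ?_) (fun j => ?_) _
      ⟨_, closedBall_mem_horocycle hX hA x⟩ (Metric.closedBall_subset_closedBall hrA)
    · have hpos := B.2.1.measureReal_pos m
      rw [← norm_sq_ballInd m B.2.1] at hpos
      have hne : ((‖ballInd m B.2.1‖ : ℝ) : ℂ) ≠ 0 := fun h0 => by
        rw [Complex.ofReal_eq_zero] at h0
        rw [h0] at hpos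
        norm_num at hpos
      have h := Submodule.smul_mem ((model m hX hC hA σ).graph.map (LinearMap.fst ℂ _ _))
        ((‖ballInd m B.2.1‖ : ℝ) : ℂ) ⟨_, (model m hX hC hA σ).e_mem_graph B, rfl⟩
      have he : ((‖ballInd m B.2.1‖ : ℝ) : ℂ) • (model m hX hC hA σ).e B = ballInd m B.2.1 := by
        change ((‖ballInd m B.2.1‖ : ℝ) : ℂ) • (((‖ballInd m B.2.1‖)⁻¹ : ℝ) : ℂ) •
          ballInd m B.2.1 = _
        rw [smul_smul, Complex.ofReal_inv, mul_inv_cancel₀ hne, one_smul]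
      rwa [LinearMap.fst_apply, he] at h
    · exact ⟨_, (model m hX hC hA σ).v_mem_graph j, rfl⟩
  have hsub : p - q ∈ (minimalOperator C m (potential A σ)).graph := by
    rw [minimalOperator_graph]
    exact Submodule.sub_mem _ hp (hle hq)
  have hfst : (p - q).1 = 0 := sub_eq_zero.2 hqp.symm
  have hsnd : (p - q).2 = 0 := LinearPMap.graph_fst_eq_zero_snd _ hsub hfst
  rwa [sub_eq_zero.1 (Prod.ext hfst hsnd : p - q = 0)]

/-- `LinearPMap.closure` has the expected graph only for closable operators; closability comes from
the symmetry of the densely defined block model. -/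
theorem schrodinger_graph : (schrodinger C m (potential A σ)).graph =
    (model m hX hC hA σ).graph.topologicalClosure := by
  have hcl : (minimalOperator C m (potential A σ)).IsClosable := by
    refine ⟨(model m hX hC hA σ).graph.topologicalClosure.toLinearPMap, ?_⟩
    rw [minimalOperator_graph, ← model_graph m hX hC hA σ, Submodule.toLinearPMap_graph_eq]
    exact fun p hp h => (model m hX hC hA σ).snd_eq_zero_of_mem_closure p hp h
  rw [schrodinger, ← hcl.graph_closure_eq_closure_graph, minimalOperator_graph,
    ← model_graph m hX hC hA σ]

/-! ### The spectrum of the restriction of the Laplacian to a ball -/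

omit [ProperSpace X] [MeasurableSpace X] [BorelSpace X] [IsUltrametricDist X] [NoncompactSpace X]
  [PerfectSpace X] in
theorem potential_zero : potential A (fun _ => 0) = 0 := by
  funext x
  simp [potential]

theorem laplacian_graph : (laplacian C m).graph =
    (model m hX hC hA fun _ => 0).graph.topologicalClosure := by
  rw [← schrodinger_graph, potential_zero, laplacian]

omit [m.IsOpenPosMeasure] [IsUltrametricDist X] [NoncompactSpace X] [PerfectSpace X] in
theorem haarVec_mem_localSpace (j : LocalPair A) (hj : (j.block : Set X) = A) :
    haarVec m j.isParent ∈ localSpace m A :=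
  Submodule.le_topologicalClosure _ (Submodule.subset_span
    ⟨j.1.1, j.1.2, j.isParent, by have h := j.ssubset_block; rwa [hj] at h,
      haarVec_coeFn m j.isParent⟩)

omit [m.IsOpenPosMeasure] [NoncompactSpace X] [PerfectSpace X] in
theorem eq_zero_of_orthogonal_haarVec (hA : IsBall A) (y : Lp ℂ 2 m) (hy : y ∈ localSpace m A)
    (h : ∀ j : LocalPair A, (j.block : Set X) = A → ⟪haarVec m j.isParent, y⟫ = 0) : y = 0 := by
  have hle : localSpace m A ≤ (Submodule.span ℂ {y})ᗮ := by
    refine Submodule.topologicalClosure_minimal _ (Submodule.span_le.2 ?_)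
      (Submodule.isClosed_orthogonal _)
    rintro u ⟨T, T', hp, hTA, hu⟩
    let j : LocalPair A := ⟨(T, T'), hp, ⟨A, hA, rfl⟩, hTA⟩
    have huj : u = haarVec m j.isParent := Lp.ext (hu.trans (haarVec_coeFn m hp).symm)
    rw [SetLike.mem_coe, Submodule.mem_orthogonal_singleton_iff_inner_left, huj]
    exact h j (congrArg Subtype.val (j.block_eq ⟨A, hA, rfl⟩ hTA))
  exact inner_self_eq_zero.1 ((Submodule.mem_orthogonal_singleton_iff_inner_left).1 (hle hy))

include hX hC hA

theorem haarVec_mem_laplacian_graph (j : LocalPair A) :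
    (haarVec m j.isParent, (eigenvalue C j.1.2 : ℂ) • haarVec m j.isParent) ∈
      (laplacian C m).graph := by
  rw [laplacian_graph m hX hC hA]
  have h := (model m hX hC hA fun _ => 0).v_mem_graph j
  have hmu : (model m hX hC hA fun _ => 0).mu j = eigenvalue C j.1.2 := add_zero _
  rw [hmu] at h
  exact Submodule.le_topologicalClosure _ h

/-- The pair may sit in another block, but the same eigenvalue is realised by an `f_T` with `T`
inside `A`. -/
theorem eigenvalue_mem_localSpectrum (j : LocalPair A) :
    (eigenvalue C j.1.2 : ℂ) ∈ localSpectrum C m A := by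
  obtain ⟨k, hk, hkj⟩ := LocalPair.exists_eigenvalue hX hC ⟨A, hA, rfl⟩ j
  rw [← hkj]
  have hkA : (k.block : Set X) = A := congrArg Subtype.val hk
  refine UnboundedOp.mem_spec_of_mem_closure _ {(eigenvalue C k.1.2 : ℂ)} ?_ _
    (subset_closure rfl)
  rintro _ rfl
  refine ⟨⟨haarVec m k.isParent, haarVec_mem_localSpace m k hkA⟩, ?_, fun h => ?_⟩
  · rw [UnboundedOp.mem_eigenspace_iff_mem_graph, UnboundedOp.restrict_graph]
    exact haarVec_mem_laplacian_graph m hX hC hA k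
  · exact haarVec_ne_zero m k.isParent (congrArg Subtype.val h)

/-- Inside `localSpace m A` the operator is diagonal on a total family, so the distance from `z` to
the eigenvalues is a lower bound on the core, and no compactness is needed. -/
theorem localSpectrum_subset : localSpectrum C m A ⊆
    closure (Set.range fun j : LocalPair A => (eigenvalue C j.1.2 : ℂ)) := by
  intro z hz
  by_contra hcon
  refine hz ?_
  obtain ⟨c, hc, hdist⟩ : ∃ c > 0, ∀ j : LocalPair A, c ≤ ‖(eigenvalue C j.1.2 : ℂ) - z‖ := by
    rw [Metric.mem_closure_iff] at hcon
    push Not at hcon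
    obtain ⟨c, hc, h⟩ := hcon
    exact ⟨c, hc, fun j => by rw [← dist_eq_norm, dist_comm]; exact h _ ⟨j, rfl⟩⟩
  have : CompleteSpace (localSpace m A) := Submodule.topologicalClosure.completeSpace _
  let JA := {j : LocalPair A // (j.block : Set X) = A}
  let v : JA → localSpace m A := fun j => ⟨haarVec m j.1.isParent, haarVec_mem_localSpace m j.1 j.2⟩
  let μ : JA → ℝ := fun j => eigenvalue C j.1.1.2
  let G : Submodule ℂ (localSpace m A × localSpace m A) :=
    Submodule.span ℂ (Set.range fun j => (v j, (μ j : ℂ) • v j))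
  have hgraph := UnboundedOp.restrict_graph (laplacian C m) (localSpace m A)
  have hGle : G ≤ (UnboundedOp.restrict (laplacian C m) (localSpace m A)).graph := by
    rw [hgraph]
    refine Submodule.span_le.2 ?_
    rintro _ ⟨j, rfl⟩
    exact haarVec_mem_laplacian_graph m hX hC hA j.1
  have hsymm : ∀ p ∈ (UnboundedOp.restrict (laplacian C m) (localSpace m A)).graph,
      ∀ q ∈ (UnboundedOp.restrict (laplacian C m) (localSpace m A)).graph,
      ⟪q.2, p.1⟫ = ⟪q.1, p.2⟫ := by
    intro p hp q hq
    rw [hgraph] at hp hq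
    have hp' : ((p.1 : Lp ℂ 2 m), (p.2 : Lp ℂ 2 m)) ∈ (laplacian C m).graph := hp
    have hq' : ((q.1 : Lp ℂ 2 m), (q.2 : Lp ℂ 2 m)) ∈ (laplacian C m).graph := hq
    rw [laplacian_graph m hX hC hA] at hp' hq'
    exact (model m hX hC hA fun _ => 0).inner_symm _ hp' _ hq'
  have hclosed : IsClosed ((UnboundedOp.restrict (laplacian C m) (localSpace m A)).graph :
      Set (localSpace m A × localSpace m A)) := by
    rw [hgraph]
    have hcl : IsClosed ((laplacian C m).graph : Set (Lp ℂ 2 m × Lp ℂ 2 m)) := by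
      rw [laplacian_graph m hX hC hA]
      exact Submodule.isClosed_topologicalClosure _
    exact hcl.preimage (f := fun p : localSpace m A × localSpace m A =>
      ((p.1 : Lp ℂ 2 m), (p.2 : Lp ℂ 2 m))) (by fun_prop)
  have hdense : ∀ w : ℂ, (∀ j, (μ j : ℂ) ≠ w) → ∀ y, (∀ p ∈ G, ⟪p.2 - w • p.1, y⟫ = 0) →
      y = 0 := by
    intro w hw y hy
    refine Subtype.ext (eq_zero_of_orthogonal_haarVec m hA y y.2 fun j hj => ?_)
    have h := hy _ (Submodule.subset_span ⟨⟨j, hj⟩, rfl⟩)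
    simp only [← sub_smul, inner_smul_left] at h
    refine (mul_eq_zero.1 h).resolve_left fun h0 => hw ⟨j, hj⟩ ?_
    rwa [map_eq_zero, sub_eq_zero] at h0
  have hne : ∀ j, (μ j : ℂ) ≠ z := fun j h => by
    have := hdist j.1
    rw [show (eigenvalue C j.1.1.2 : ℂ) = z from h, sub_self, norm_zero] at this
    linarith
  refine UnboundedOp.mem_resolventSet_of_symmetric_core _ G hclosed hGle
    (fun p hp q hq => hsymm p hp q (hGle hq)) z c hc ?_ (hdense z hne)
    (hdense _ fun j h => hne j ?_)
  · refine UnboundedOp.lower_bound_of_mem_span_eigenvectors v μ (fun j k hjk => ?_) z c hc.le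
      fun j => hdist j.1
    exact (model m hX hC hA fun _ => 0).inner_v_v_of_lam j.1 k.1 hjk
  · rw [← Complex.conj_conj z, ← h, Complex.conj_ofReal]

end Hierarchical

end

/-! ### The theorem, deduced from the block model -/

theorem mainTheorem12 {X : Type*} [MetricSpace X] [IsUltrametricDist X] [ProperSpace X]
    [NoncompactSpace X] [PerfectSpace X] [MeasurableSpace X] [BorelSpace X]
    (hX : Hierarchical.IsHomogeneous X)
    (m : Measure X) [IsFiniteMeasureOnCompacts m] [m.IsOpenPosMeasure]
    (hm : ∀ e : X ≃ᵢ X, MeasurePreserving e m m)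
    (C : Set X → ℝ) (hC : Hierarchical.IsChoiceFunction C)
    (A : Set X) (hA : Hierarchical.IsBall A)
    (σ : Hierarchical.horocycle A → ℝ)
    (V : X → ℝ) (hV : V = Hierarchical.potential A σ)
    (S R : Set ℂ) (hS : S = Hierarchical.localSpectrum C m A)
    (hR : R = Hierarchical.potentialRange V) :
    (UnboundedOp.HasDiscreteSpectrum (Hierarchical.schrodinger C m V) →
      Tendsto (fun x => |V x|) (cocompact X) atTop) ∧
    (Tendsto (fun x => |V x|) (cocompact X) atTop →
      (UnboundedOp.NoAccPts (UnboundedOp.spec (Hierarchical.schrodinger C m V)) ↔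
        UnboundedOp.NoAccPts (S + R)) ∧
      (UnboundedOp.HasDiscreteSpectrum (Hierarchical.schrodinger C m V) ↔
        UnboundedOp.NoAccPts (S + R) ∧
          ∀ z : ℂ, {p : ℂ × ℂ | p.1 ∈ S ∧ p.2 ∈ R ∧ p.1 + p.2 = z}.Finite)) := by
  subst hV hS hR
  have hne : Nonempty (Hierarchical.horocycle A) := ⟨⟨A, hA, rfl⟩⟩
  have hne' : Nonempty (Hierarchical.LocalPair A) := Hierarchical.LocalPair.nonempty hA
  have hR : Hierarchical.potentialRange (Hierarchical.potential A σ) =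
      (Hierarchical.model m hX hC hA σ).sigmaRange := by
    ext z
    constructor
    · rintro ⟨x, rfl⟩
      refine ⟨⟨_, Hierarchical.closedBall_mem_horocycle hX hA x⟩, ?_⟩
      have hx : x ∈ Metric.closedBall x (Metric.diam A) :=
        Metric.mem_closedBall_self Metric.diam_nonneg
      exact congrArg Complex.ofReal (Hierarchical.potential_eq σ
        ⟨_, Hierarchical.closedBall_mem_horocycle hX hA x⟩ hx).symm
    · rintro ⟨B, rfl⟩
      obtain ⟨x, hx⟩ := B.2.1.nonempty
      exact ⟨x, congrArg Complex.ofReal (Hierarchical.potential_eq σ B hx)⟩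
  rw [Hierarchical.tendsto_potential_iff hX hA σ, hR]
  refine (Hierarchical.model m hX hC hA σ).spectrum_dichotomy _
    (Hierarchical.schrodinger_graph m hX hC hA σ) _ ?_
    (Hierarchical.localSpectrum_subset m hX hC hA)
  rintro _ ⟨j, rfl⟩
  exact Hierarchical.eigenvalue_mem_localSpectrum m hX hC hA j
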